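/- Let $A=\left(\begin{smallmatrix}1&1\\0&1\end{smallmatrix}\right)$ act on $\mathbb T^2=\mathbb R^2/\mathbb Z^2$ with coordinates $(x,y)$, so $A(x,y)=(x+y,y)$. Let $M=(\mathbb T^2\times[0,1])/((t,0)\sim(At,1))$ be its suspension, a smooth manifold with universal cover $q:\mathbb R^2\times\mathbb R\to M$, $q(t,s)=q(At,s+1)$, and let $\mathcal F_A$ be the codimension two foliation of $M$ whose leaves are the images of the lines $\{t\}\times\mathbb R$. A smooth form $\alpha$ on $M$ is basic if $i_X\alpha=i_Xd\alpha=0$ for all $X$ tangent to the leaves; $\Omega^k(M/\mathcal F_A)$ is the space of basic $k$-forms. Then: 1. The form $\omega=dx\wedge dy$ on $\mathbb T^2$ is $A$-invariant, closed and non-degenerate, so $\mathcal F_A$ is transversely symplectic. For every $k$ there is a linear isomorphism from $\Omega^k(M/\mathcal F_A)$ onto the space of $A$-invariant smooth $k$-forms on $\mathbb T^2$ that maps $\alpha$ to $\tau$ with $q^*\alpha=\mathrm{pr}^*\tau$, where $\mathrm{pr}(t,s)=t$; it commutes with $d$. Basic forms are identified with invariant forms on $\mathbb T^2$ in this way from now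 on. 2. With $\mathbb S^1=\mathbb R/\mathbb Z$, $$\Omega^0=\{f(y)\},\quad \Omega^1=\{f(y)\,dy\},\quad \Omega^2=\{f(y)\,dx\wedge dy\},\qquad f\in C^\infty(\mathbb S^1),$$ where $f$ is determined by the form, and $\Omega^k=0$ for $k\ge 3$. 3. Let $G$ be the pairing on $k$-covectors induced by $\omega$ (on $1$-covectors, $G(\alpha,\beta)=\omega(\alpha^\sharp,\beta^\sharp)$ with $\omega(\alpha^\sharp,\cdot)=\alpha$; on $k$-covectors, $G(\alpha,\beta)=\frac1{k!}\sum G^{i_1j_1}\cdots G^{i_kj_k}\alpha_{i_1\dots i_k}\beta_{j_1\dots j_k}$). Let $*_s:\Omega^k\to\Omega^{2-k}$ be the symplectic star operator, defined pointwise by $\alpha\wedge *_s\beta=G(\alpha,\beta)\,\omega$ for all $k$-covectors $\alpha$, let $d^\Lambda=(-1)^{k+1}*_sd*_s$ on $\Omega^k$, and let $$H^\bullet=\frac{\ker d}{\operatorname{im}d},\qquad H^\bullet_{d+d^\Lambda}=\frac{\ker(d+d^\Lambda)}{\operatorname{im}dd^\Lambda},\qquad H^\bullet_{dd^\Lambda}=\frac{\ker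 dd^\Lambda}{\operatorname{im}d+\operatorname{im}d^\Lambda}.$$ Then, as real vector spaces, $$H^0\cong\mathbb R,\quad H^1\cong\mathbb R,\quad H^2\cong C^\infty(\mathbb S^1),$$ $$H^0_{d+d^\Lambda}\cong\mathbb R,\quad H^1_{d+d^\Lambda}\cong C^\infty(\mathbb S^1),\quad H^2_{d+d^\Lambda}\cong\mathbb R,$$ $$H^0_{dd^\Lambda}\cong C^\infty(\mathbb S^1),\quad H^1_{dd^\Lambda}\cong\mathbb R,\quad H^2_{dd^\Lambda}\cong C^\infty(\mathbb S^1).$$ Each isomorphism with $C^\infty(\mathbb S^1)$ maps the class of the form with coefficient $f$ to $f$. The isomorphisms of $H^0$, $H^0_{d+d^\Lambda}$ and $H^2_{d+d^\Lambda}$ with $\mathbb R$ map a class to the constant coefficient of its representing form, and those of $H^1$ and $H^1_{dd^\Lambda}$ map $[f(y)\,dy]$ to $\int_0^1f(y)\,dy$. In particular $H^2$, $H^1_{d+d^\Lambda}$, $H^0_{dd^\Lambda}$ and $H^2_{dd^\Lambda}$ are infinite dimensional. -/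

import Mathlib

open scoped Manifold ContDiff Topology

namespace Suspension

/-! ### The suspension manifold -/

/-- The plane, with coordinates `x = v 0` and `y = v 1`; the torus is its quotient by `ℤ²`. -/
abbrev Plane : Type := Fin 2 → ℝ

/-- The universal cover of the suspension, with points `(t, s)`, `t` in the plane. -/
abbrev Space : Type := Plane × ℝ

/-- The linear map with matrix `A = [[1, 1], [0, 1]]`, that is `(x, y) ↦ (x + y, y)`. -/
noncomputable def linA : Plane →L[ℝ] Plane :=
  LinearMap.toContinuousLinearMap (Matrix.toLin' !![1, 1; 0, 1])

theorem linA_apply (v : Plane) : linA v = ![v 0 + v 1, v 1] := by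
  ext i
  fin_cases i <;> simp [linA, Matrix.mulVec, dotProduct]

/-- The power `A ^ k`, `k ∈ ℤ`, as a linear map; see `shear_one` and `shear_add`. -/
noncomputable def shear (k : ℤ) : Plane →L[ℝ] Plane :=
  LinearMap.toContinuousLinearMap (Matrix.toLin' !![1, (k : ℝ); 0, 1])

theorem shear_apply (k : ℤ) (t : Plane) : shear k t = ![t 0 + k * t 1, t 1] := by
  ext i
  fin_cases i <;> simp [shear, Matrix.mulVec, dotProduct]

theorem shear_one : shear 1 = linA := by
  ext v i
  fin_cases i <;> simp [shear_apply, linA_apply]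

theorem shear_add (k l : ℤ) (t : Plane) : shear (k + l) t = shear k (shear l t) := by
  ext i
  fin_cases i
  · simp [shear_apply]; ring
  · simp [shear_apply]

/-- The group of deck transformations of `Space` over the suspension: the element `(m, n, k)`
stands for `(t, s) ↦ (A ^ k t + (m, n), s + k)`. It is generated by the two unit translations of
the plane, whose quotient is `T² × ℝ`, and by `(t, s) ↦ (A t, s + 1)`. -/
@[ext]
structure Deck : Type where
  m : ℤ
  n : ℤ
  k : ℤ

namespace Deck

instance : Group Deck where
  mul g h := ⟨g.m + h.m + g.k * h.n, g.n + h.n, g.k + h.k⟩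
  one := ⟨0, 0, 0⟩
  inv g := ⟨-g.m + g.k * g.n, -g.n, -g.k⟩
  mul_assoc a b c := by
    ext
    · change a.m + b.m + a.k * b.n + c.m + (a.k + b.k) * c.n
        = a.m + (b.m + c.m + b.k * c.n) + a.k * (b.n + c.n)
      ring
    · exact add_assoc _ _ _
    · exact add_assoc _ _ _
  one_mul a := by
    ext
    · change 0 + a.m + 0 * a.n = a.m
      ring
    · exact zero_add _
    · exact zero_add _
  mul_one a := by
    ext
    · change a.m + 0 + a.k * 0 = a.m
      ring
    · exact add_zero _
    · exact add_zero _
  inv_mul_cancel a := by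
    ext
    · change -a.m + a.k * a.n + a.m + -a.k * a.n = 0
      ring
    · exact neg_add_cancel _
    · exact neg_add_cancel _

theorem mul_def (g h : Deck) : g * h = ⟨g.m + h.m + g.k * h.n, g.n + h.n, g.k + h.k⟩ := rfl

theorem one_def : (1 : Deck) = ⟨0, 0, 0⟩ := rfl

noncomputable instance : MulAction Deck Space where
  smul g p := (shear g.k p.1 + ![(g.m : ℝ), (g.n : ℝ)], p.2 + g.k)
  one_smul p := by
    change (shear 0 p.1 + ![((0 : ℤ) : ℝ), ((0 : ℤ) : ℝ)], p.2 + ((0 : ℤ) : ℝ)) = p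
    ext i
    · fin_cases i <;> simp [shear_apply]
    · simp
  mul_smul g h p := by
    change (shear (g.k + h.k) p.1
        + ![((g.m + h.m + g.k * h.n : ℤ) : ℝ), ((g.n + h.n : ℤ) : ℝ)], p.2 + ((g.k + h.k : ℤ) : ℝ))
      = (shear g.k (shear h.k p.1 + ![(h.m : ℝ), (h.n : ℝ)]) + ![(g.m : ℝ), (g.n : ℝ)],
          p.2 + h.k + g.k)
    ext i
    · fin_cases i
      · simp [shear_apply]; ring
      · simp [shear_apply]; ring
    · simp; ring

theorem smul_def (g : Deck) (p : Space) :
    g • p = (shear g.k p.1 + ![(g.m : ℝ), (g.n : ℝ)], p.2 + g.k) := rfl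

instance : ContinuousConstSMul Deck Space where
  continuous_const_smul g := by
    simp only [smul_def]
    fun_prop

instance : IsCancelSMul Deck Space where
  left_cancel' g p q h := smul_left_cancel g h
  right_cancel' g h p e := by
    simp only [smul_def, Prod.mk.injEq, add_right_inj, Int.cast_inj] at e
    obtain ⟨e₁, e₂⟩ := e
    rw [e₂] at e₁
    have h₀ := congrFun e₁ 0
    have h₁ := congrFun e₁ 1
    simp at h₀ h₁
    ext
    · exact h₀
    · exact h₁
    · exact e₂

instance : ProperlyDiscontinuousSMul Deck Space where
  finite_disjoint_inter_image := by
    intro K L hK hL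
    obtain ⟨c, hc⟩ := hK.isBounded.exists_norm_le
    obtain ⟨d, hd⟩ := hL.isBounded.exists_norm_le
    obtain ⟨N, hN⟩ := exists_nat_ge (c + d + (c + d) * c)
    have hfin : (((Set.Icc (-(N : ℤ)) N) ×ˢ (Set.Icc (-(N : ℤ)) N)) ×ˢ
        (Set.Icc (-(N : ℤ)) N)).Finite :=
      ((Set.finite_Icc _ _).prod (Set.finite_Icc _ _)).prod (Set.finite_Icc _ _)
    refine (hfin.image (fun z : (ℤ × ℤ) × ℤ => (⟨z.1.1, z.1.2, z.2⟩ : Deck))).subset ?_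
    rintro g ⟨q, ⟨p, hp, rfl⟩, hq⟩
    have hp' := hc p hp
    have hq' := hd _ hq
    have hc0 : 0 ≤ c := (norm_nonneg _).trans hp'
    have hd0 : 0 ≤ d := (norm_nonneg _).trans hq'
    have hp1 := (norm_fst_le p).trans hp'
    have hp2 := (norm_snd_le p).trans hp'
    have hp10 := (norm_le_pi_norm p.1 0).trans hp1
    have hp11 := (norm_le_pi_norm p.1 1).trans hp1
    have hq1 := (norm_fst_le _).trans hq'
    have hq2 := (norm_snd_le _).trans hq'
    have hq10 := (norm_le_pi_norm _ 0).trans hq1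
    have hq11 := (norm_le_pi_norm _ 1).trans hq1
    simp [smul_def, shear_apply, Real.norm_eq_abs] at hp10 hp11 hp2 hq10 hq11 hq2
    have hk : |(g.k : ℝ)| ≤ c + d := by
      calc |(g.k : ℝ)| = |(p.2 + g.k) - p.2| := by ring_nf
        _ ≤ |p.2 + g.k| + |p.2| := abs_sub _ _
        _ ≤ c + d := by linarith
    have hn : |(g.n : ℝ)| ≤ c + d := by
      calc |(g.n : ℝ)| = |(p.1 1 + g.n) - p.1 1| := by ring_nf
        _ ≤ |p.1 1 + g.n| + |p.1 1| := abs_sub _ _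
        _ ≤ c + d := by linarith
    have hky : |(g.k : ℝ) * p.1 1| ≤ (c + d) * c := by
      rw [abs_mul]
      gcongr
    have hm : |(g.m : ℝ)| ≤ c + d + (c + d) * c := by
      calc |(g.m : ℝ)| = |(p.1 0 + g.k * p.1 1 + g.m) - (p.1 0 + g.k * p.1 1)| := by ring_nf
        _ ≤ |p.1 0 + g.k * p.1 1 + g.m| + |p.1 0 + g.k * p.1 1| := abs_sub _ _
        _ ≤ |p.1 0 + g.k * p.1 1 + g.m| + (|p.1 0| + |g.k * p.1 1|) := by
          gcongr; exact abs_add_le _ _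
        _ ≤ c + d + (c + d) * c := by linarith
    have hcd : 0 ≤ (c + d) * c := by positivity
    have key : ∀ z : ℤ, |(z : ℝ)| ≤ c + d + (c + d) * c → z ∈ Set.Icc (-(N : ℤ)) N := by
      intro z hz
      have := abs_le.1 (hz.trans hN)
      constructor
      · exact_mod_cast this.1
      · exact_mod_cast this.2
    exact ⟨((g.m, g.n), g.k), ⟨⟨key _ hm, key _ (by linarith)⟩, key _ (by linarith)⟩, rfl⟩

end Deck


instance : ChartedSpace Space Space := chartedSpaceSelf Space

/-- The suspension `(T² × [0, 1]) / ((t, 0) ∼ (A t, 1))`, as the quotient manifold of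
`ℝ² × ℝ` by the deck group. -/
def M : Type := MulAction.orbitRel.Quotient Deck Space

noncomputable instance : TopologicalSpace M :=
  inferInstanceAs (TopologicalSpace (MulAction.orbitRel.Quotient Deck Space))

noncomputable instance : ChartedSpace Space M :=
  inferInstanceAs (ChartedSpace Space (MulAction.orbitRel.Quotient Deck Space))

/-- The covering map. -/
noncomputable def proj (p : Space) : M := Quotient.mk (MulAction.orbitRel Deck Space) p

theorem exists_smul_of_proj_eq {p p' : Space} (h : proj p = proj p') : ∃ g : Deck, g • p = p' := by
  obtain ⟨g, hg⟩ := MulAction.orbitRel_apply.1 (Quotient.exact h.symm)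
  exact ⟨g, hg⟩

theorem proj_smul (g : Deck) (p : Space) : proj (g • p) = proj p :=
  Quotient.sound (MulAction.orbitRel_apply.2 ⟨g, rfl⟩)

theorem symm_eq_proj {e : OpenPartialHomeomorph M Space} (he : e ∈ atlas Space M) :
    (e.symm : Space → M) = proj := by
  obtain ⟨x, rfl⟩ := he
  rw [chartAt_self_eq, OpenPartialHomeomorph.trans_refl]
  exact IsLocalHomeomorph.localInverseAt_symm _ _

instance : IsManifold 𝓘(ℝ, Space) ∞ M := by
  apply isManifold_of_contDiffOn
  intro e e' he he' z hz
  have hs := symm_eq_proj he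
  have hs' := symm_eq_proj he'
  simp only [modelWithCornersSelf_coe, modelWithCornersSelf_coe_symm, Set.preimage_id_eq, id_eq,
    Set.range_id, Set.inter_univ, OpenPartialHomeomorph.trans_source,
    OpenPartialHomeomorph.symm_source, hs, Function.id_comp, Function.comp_id,
    OpenPartialHomeomorph.coe_trans] at hz ⊢
  obtain ⟨hz, hz'⟩ := hz
  have hw : proj (e' (proj z)) = proj z := by
    have h := e'.left_inv (show proj z ∈ e'.source from hz')
    rwa [hs'] at h
  obtain ⟨g, hg⟩ := exists_smul_of_proj_eq hw.symm
  have hcont : Continuous fun w : Space => g • w := continuous_const_smul g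
  have hnear : ∀ᶠ w in 𝓝 z, g • w ∈ e'.target := by
    refine hcont.continuousAt.eventually_mem (e'.open_target.mem_nhds ?_)
    simp only [hg]
    exact e'.map_source hz'
  have heq : (fun w => e' (proj w)) =ᶠ[𝓝 z] fun w => g • w := by
    filter_upwards [hnear] with w hw
    rw [← proj_smul g w, ← hs', e'.right_inv hw]
  have hsm : ContDiff ℝ ∞ fun w : Space => g • w := by
    simp only [Deck.smul_def]
    fun_prop
  exact (hsm.contDiffAt.congr_of_eventuallyEq heq).contDiffWithinAt

/-! ### Differential forms on a manifold modelled on a normed space -/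

section Forms

variable {E : Type*} [NormedAddCommGroup E] [NormedSpace ℝ E]
  {X : Type*} [TopologicalSpace X] [ChartedSpace E X]

/-- Differential `k`-forms on `X`, without any smoothness requirement. -/
abbrev DiffForm (E : Type*) [NormedAddCommGroup E] [NormedSpace ℝ E]
    (X : Type*) [TopologicalSpace X] [ChartedSpace E X] (k : ℕ) : Type _ :=
  (x : X) → TangentSpace 𝓘(ℝ, E) x [⋀^Fin k]→L[ℝ] ℝ

/-- The expression of a form in the preferred chart at `x`, that is, its pullback under the
inverse of the chart. -/
noncomputable def chartForm {k : ℕ} (α : DiffForm E X k) (x : X) (z : E) : E [⋀^Fin k]→L[ℝ] ℝ :=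
  (α ((chartAt E x).symm z)).compContinuousLinearMap
    (mfderiv 𝓘(ℝ, E) 𝓘(ℝ, E) (chartAt E x).symm z)

/-- Smoothness of a form, in charts. -/
def IsSmoothForm {k : ℕ} (α : DiffForm E X k) : Prop :=
  ∀ x : X, ContDiffOn ℝ ∞ (chartForm α x) (chartAt E x).target

/-- The exterior derivative of a form on a manifold: at `x` it is computed in the chart at `x`. -/
noncomputable def extDerivForm {k : ℕ} (α : DiffForm E X k) : DiffForm E X (k + 1) := fun x =>
  (extDeriv (chartForm α x) (chartAt E x x)).compContinuousLinearMap
    (mfderiv 𝓘(ℝ, E) 𝓘(ℝ, E) (chartAt E x) x)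

/-- `i_v α = 0` for all `v ∈ L`. As `α` is alternating, the slot in which `v` is inserted does not
matter; for `k = 0` there is no slot and no condition. -/
def Annihilates {V : Type*} [AddCommGroup V] [Module ℝ V] [TopologicalSpace V] {k : ℕ}
    (L : Submodule ℝ V) (α : V [⋀^Fin k]→L[ℝ] ℝ) : Prop :=
  ∀ w : Fin k → V, (∃ i, w i ∈ L) → α w = 0

theorem chartForm_add {k : ℕ} (α β : DiffForm E X k) (x : X) :
    chartForm (α + β) x = chartForm α x + chartForm β x := rfl

theorem chartForm_smul {k : ℕ} (c : ℝ) (α : DiffForm E X k) (x : X) :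
    chartForm (c • α) x = c • chartForm α x := rfl

theorem IsSmoothForm.differentiableAt {k : ℕ} {α : DiffForm E X k} (h : IsSmoothForm α) (x : X) :
    DifferentiableAt ℝ (chartForm α x) (chartAt E x x) :=
  (((h x).contDiffAt ((chartAt E x).open_target.mem_nhds (mem_chart_target E x)))).differentiableAt
    (by simp)

theorem extDerivForm_add {k : ℕ} {α β : DiffForm E X k} (hα : IsSmoothForm α)
    (hβ : IsSmoothForm β) : extDerivForm (α + β) = extDerivForm α + extDerivForm β := by
  funext x
  simp only [extDerivForm, Pi.add_apply, chartForm_add]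
  rw [extDeriv_add (hα.differentiableAt x) (hβ.differentiableAt x)]
  rfl

theorem extDerivForm_smul {k : ℕ} (c : ℝ) (α : DiffForm E X k) :
    extDerivForm (c • α) = c • extDerivForm α := by
  funext x
  simp only [extDerivForm, Pi.smul_apply, chartForm_smul]
  rw [extDeriv_smul]
  rfl

theorem extDerivForm_zero {k : ℕ} : extDerivForm (0 : DiffForm E X k) = 0 := by
  have := extDerivForm_smul (0 : ℝ) (0 : DiffForm E X k)
  rwa [zero_smul, zero_smul] at this

/-- The basic `k`-forms of a foliation with tangent spaces `D x`: smooth forms `α` with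
`i_v α = 0` and `i_v dα = 0` for all `v` tangent to the leaves. -/
def basicForms (D : (x : X) → Submodule ℝ (TangentSpace 𝓘(ℝ, E) x)) (k : ℕ) :
    Submodule ℝ (DiffForm E X k) where
  carrier := {α | IsSmoothForm α ∧
    ∀ x, Annihilates (D x) (α x) ∧ Annihilates (D x) (extDerivForm α x)}
  zero_mem' := by
    refine ⟨fun x => contDiffOn_const (c := 0), fun x => ⟨fun _ _ => rfl, fun w _ => ?_⟩⟩
    rw [extDerivForm_zero]
    rfl
  add_mem' := by
    rintro α β ⟨hα, hα'⟩ ⟨hβ, hβ'⟩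
    refine ⟨fun x => (hα x).add (hβ x), fun x => ⟨fun w hw => ?_, fun w hw => ?_⟩⟩
    · change α x w + β x w = 0
      rw [(hα' x).1 w hw, (hβ' x).1 w hw, add_zero]
    · rw [extDerivForm_add hα hβ]
      change extDerivForm α x w + extDerivForm β x w = 0
      rw [(hα' x).2 w hw, (hβ' x).2 w hw, add_zero]
  smul_mem' := by
    rintro c α ⟨hα, hα'⟩
    refine ⟨fun x => (hα x).const_smul c, fun x => ⟨fun w hw => ?_, fun w hw => ?_⟩⟩
    · change c • α x w = 0
      rw [(hα' x).1 w hw, smul_zero]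
    · rw [extDerivForm_smul]
      change c • extDerivForm α x w = 0
      rw [(hα' x).2 w hw, smul_zero]

end Forms

/-! ### The suspension foliation -/

/-- The leaf through `proj (t, 0)`, parametrized by `s ↦ proj (t, s)`. -/
noncomputable def leaf (t : Plane) (s : ℝ) : M := proj (t, s)

/-- The tangent line to the leaf through `x`, spanned by the velocities of the leaves at `x`. -/
noncomputable def leafTangent (x : M) : Submodule ℝ (TangentSpace 𝓘(ℝ, Space) x) :=
  Submodule.span ℝ {v | ∃ (t : Plane) (s : ℝ), leaf t s = x ∧
    (v : Space) = mfderiv 𝓘(ℝ, ℝ) 𝓘(ℝ, Space) (leaf t) s (1 : ℝ)}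

/-! ### The symplectic star on covectors of the transversal -/

section Sympl

/-- The symplectic form `dx ∧ dy`. -/
noncomputable def areaForm : Plane [⋀^Fin 2]→L[ℝ] ℝ where
  toMultilinearMap := (Matrix.detRowAlternating : Plane [⋀^Fin 2]→ₗ[ℝ] ℝ).toMultilinearMap
  map_eq_zero_of_eq' := (Matrix.detRowAlternating : Plane [⋀^Fin 2]→ₗ[ℝ] ℝ).map_eq_zero_of_eq'
  cont := Continuous.matrix_det continuous_id

theorem areaForm_apply (v : Fin 2 → Plane) : areaForm v = v 0 0 * v 1 1 - v 0 1 * v 1 0 :=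
  Matrix.det_fin_two (Matrix.of v)

/-- The wedge product of covectors. -/
noncomputable def wedge {k l : ℕ} (α : Plane [⋀^Fin k]→L[ℝ] ℝ) (β : Plane [⋀^Fin l]→L[ℝ] ℝ)
    (v : Fin (k + l) → Plane) : ℝ :=
  ((k.factorial : ℝ) * l.factorial)⁻¹ * ∑ σ : Equiv.Perm (Fin (k + l)),
    ((Equiv.Perm.sign σ : ℤ) : ℝ) *
      (α (fun i => v (σ (Fin.castAdd l i))) * β (fun j => v (σ (Fin.natAdd k j))))

/-- The basis `∂/∂x, ∂/∂y`. -/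
noncomputable def stdBasis (i : Fin 2) : Plane := Pi.single i 1

/-- The pairing that the symplectic form induces on 1-covectors, `G(dxᵢ, dxⱼ) = ω(dxᵢ♯, dxⱼ♯)` where
`ω(η♯, ·) = η`; its matrix is the inverse transpose of the matrix of `ω`. -/
noncomputable def poissonMatrix : Matrix (Fin 2) (Fin 2) ℝ :=
  (Matrix.of fun i j => areaForm ![stdBasis i, stdBasis j])⁻¹.transpose

/-- The extension of the pairing to `k`-covectors,
`G(α, β) = (1 / k!) ∑ G^{i₁j₁} ⋯ G^{iₖjₖ} α_{i₁…iₖ} β_{j₁…jₖ}`. -/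
noncomputable def pairing {k : ℕ} (α β : Plane [⋀^Fin k]→L[ℝ] ℝ) : ℝ :=
  ((k.factorial : ℝ))⁻¹ * ∑ i : Fin k → Fin 2, ∑ j : Fin k → Fin 2,
    (∏ a, poissonMatrix (i a) (j a)) * (α (fun a => stdBasis (i a)) * β (fun a => stdBasis (j a)))

/-- `γ` is the symplectic star of `β`: `α ∧ γ = G(α, β) ω` for all `k`-covectors `α`. -/
def IsStar {k l : ℕ} (h : k + l = 2) (β : Plane [⋀^Fin k]→L[ℝ] ℝ)
    (γ : Plane [⋀^Fin l]→L[ℝ] ℝ) : Prop :=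
  ∀ (α : Plane [⋀^Fin k]→L[ℝ] ℝ) (v : Fin (k + l) → Plane),
    wedge α γ v = pairing α β * areaForm (fun i => v (Fin.cast h.symm i))

theorem poissonMatrix_eq : poissonMatrix = !![0, 1; -1, 0] := by
  have h : (Matrix.of fun i j => areaForm ![stdBasis i, stdBasis j]) = !![0, 1; -1, 0] := by
    ext i j
    fin_cases i <;> fin_cases j <;> simp [areaForm_apply, stdBasis]
  rw [poissonMatrix, h, Matrix.inv_def, Matrix.adjugate_fin_two]
  ext i j
  fin_cases i <;> fin_cases j <;> simp [Matrix.det_fin_two]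

theorem sum_perm_two (f : Equiv.Perm (Fin 2) → ℝ) : ∑ σ, f σ = f 1 + f (Equiv.swap 0 1) := by
  have : (Finset.univ : Finset (Equiv.Perm (Fin 2))) = {1, Equiv.swap 0 1} := by decide
  rw [this, Finset.sum_pair (by decide)]


theorem wedge_add {k l : ℕ} (α : Plane [⋀^Fin k]→L[ℝ] ℝ) (γ γ' : Plane [⋀^Fin l]→L[ℝ] ℝ)
    (v : Fin (k + l) → Plane) : wedge α (γ + γ') v = wedge α γ v + wedge α γ' v := by
  simp only [wedge, ContinuousAlternatingMap.add_apply, mul_add, Finset.sum_add_distrib]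

theorem wedge_smul {k l : ℕ} (c : ℝ) (α : Plane [⋀^Fin k]→L[ℝ] ℝ) (γ : Plane [⋀^Fin l]→L[ℝ] ℝ)
    (v : Fin (k + l) → Plane) : wedge α (c • γ) v = c * wedge α γ v := by
  simp only [wedge, ContinuousAlternatingMap.smul_apply, smul_eq_mul, Finset.mul_sum]
  refine Finset.sum_congr rfl fun σ _ => ?_
  ring

theorem pairing_add {k : ℕ} (α β β' : Plane [⋀^Fin k]→L[ℝ] ℝ) :
    pairing α (β + β') = pairing α β + pairing α β' := by
  simp only [pairing, ContinuousAlternatingMap.add_apply, mul_add, Finset.sum_add_distrib]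

theorem pairing_smul {k : ℕ} (c : ℝ) (α β : Plane [⋀^Fin k]→L[ℝ] ℝ) :
    pairing α (c • β) = c * pairing α β := by
  simp only [pairing, ContinuousAlternatingMap.smul_apply, smul_eq_mul, Finset.mul_sum]
  refine Finset.sum_congr rfl fun σ _ => Finset.sum_congr rfl fun σ _ => ?_
  ring

theorem alt_two_apply (γ : Plane [⋀^Fin 2]→L[ℝ] ℝ) (v : Fin 2 → Plane) :
    γ v = γ stdBasis * areaForm v := by
  have h := AlternatingMap.eq_smul_basis_det (Pi.basisFun ℝ (Fin 2)) γ.toAlternatingMap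
  have h' := DFunLike.congr_fun h v
  have e : (⇑(Pi.basisFun ℝ (Fin 2)) : Fin 2 → Plane) = stdBasis := by
    funext i
    simp [stdBasis]
  rw [e, Pi.basisFun_det] at h'
  exact h'

theorem eq_const (γ : Plane [⋀^Fin 0]→L[ℝ] ℝ) (v w : Fin 0 → Plane) : γ v = γ w :=
  congrArg γ (Subsingleton.elim _ _)

theorem pairing_zero (α β : Plane [⋀^Fin 0]→L[ℝ] ℝ) (v : Fin 0 → Plane) :
    pairing α β = α v * β v := by
  simp only [pairing]
  simp
  rw [eq_const α _ v, eq_const β _ v]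

theorem pairing_one (α β : Plane [⋀^Fin 1]→L[ℝ] ℝ) :
    pairing α β = α ![stdBasis 0] * β ![stdBasis 1] - α ![stdBasis 1] * β ![stdBasis 0] := by
  have key : ∀ (f : (Fin 1 → Fin 2) → ℝ), ∑ i, f i = f ![0] + f ![1] := by
    intro f
    rw [← (Equiv.funUnique (Fin 1) (Fin 2)).symm.sum_comp, Fin.sum_univ_two]
    congr 2 <;> (ext i; fin_cases i; rfl)
  have e : ∀ i : Fin 2, (fun a : Fin 1 => stdBasis (![i] a)) = ![stdBasis i] := by
    intro i; ext a; fin_cases a; rfl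
  simp only [pairing, key, poissonMatrix_eq, e]
  simp
  ring

theorem pairing_two (α β : Plane [⋀^Fin 2]→L[ℝ] ℝ) :
    pairing α β = α stdBasis * β stdBasis := by
  have key : ∀ (f : (Fin 2 → Fin 2) → ℝ),
      ∑ i, f i = f ![0, 0] + f ![0, 1] + f ![1, 0] + f ![1, 1] := by
    intro f
    rw [← (finTwoArrowEquiv (Fin 2)).symm.sum_comp, Fintype.sum_prod_type, Fin.sum_univ_two,
      Fin.sum_univ_two, Fin.sum_univ_two, ← add_assoc]
    rfl
  have hα := alt_two_apply α
  have hβ := alt_two_apply β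
  generalize α stdBasis = a at hα ⊢
  generalize β stdBasis = b at hβ ⊢
  simp only [pairing, key, poissonMatrix_eq, hα, hβ, areaForm_apply]
  simp [stdBasis]
  ring

theorem wedge_zero_two (α : Plane [⋀^Fin 0]→L[ℝ] ℝ) (γ : Plane [⋀^Fin 2]→L[ℝ] ℝ)
    (v : Fin (0 + 2) → Plane) (u : Fin 0 → Plane) : wedge α γ v = α u * γ v := by
  have h := sum_perm_two fun σ => ((Equiv.Perm.sign σ : ℤ) : ℝ) *
      (α (fun i => v (σ (Fin.castAdd 2 i))) * γ (fun j => v (σ (Fin.natAdd 0 j))))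
  have h0 : γ (fun j => v ((1 : Equiv.Perm (Fin 2)) (Fin.natAdd 0 j))) = γ v := by
    congr 1; funext j; fin_cases j <;> rfl
  have h1 : γ (fun j => v ((Equiv.swap 0 1 : Equiv.Perm (Fin 2)) (Fin.natAdd 0 j))) = - γ v := by
    refine Eq.trans (congrArg γ ?_) (γ.map_swap v (i := 0) (j := 1) (by decide))
    funext j; fin_cases j <;> rfl
  rw [wedge]
  refine (congrArg _ h).trans ?_
  rw [h0, h1, eq_const α _ u,
    eq_const α (fun i => v ((Equiv.swap 0 1 : Equiv.Perm (Fin 2)) (Fin.castAdd 2 i))) u,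
    Equiv.Perm.sign_one, Equiv.Perm.sign_swap (by decide)]
  simp only [Nat.factorial, Units.val_one, Units.val_neg, Int.cast_neg, Int.cast_one]
  push_cast
  ring

theorem wedge_one_one (α γ : Plane [⋀^Fin 1]→L[ℝ] ℝ)
    (v : Fin (1 + 1) → Plane) : wedge α γ v = α ![v 0] * γ ![v 1] - α ![v 1] * γ ![v 0] := by
  have h := sum_perm_two fun σ => ((Equiv.Perm.sign σ : ℤ) : ℝ) *
      (α (fun i => v (σ (Fin.castAdd 1 i))) * γ (fun j => v (σ (Fin.natAdd 1 j))))
  have e : ∀ (f : Fin 1 → Plane), f = ![f 0] := by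
    intro f; funext i; fin_cases i; rfl
  rw [wedge]
  refine (congrArg _ h).trans ?_
  rw [e fun i => v ((1 : Equiv.Perm (Fin 2)) (Fin.castAdd 1 i)),
    e fun i => v ((1 : Equiv.Perm (Fin 2)) (Fin.natAdd 1 i)),
    e fun i => v ((Equiv.swap 0 1 : Equiv.Perm (Fin 2)) (Fin.castAdd 1 i)),
    e fun i => v ((Equiv.swap 0 1 : Equiv.Perm (Fin 2)) (Fin.natAdd 1 i))]
  have e0 : (Fin.castAdd 1 (0 : Fin 1)) = (0 : Fin 2) := rfl
  have e1 : (Fin.natAdd 1 (0 : Fin 1)) = (1 : Fin 2) := rfl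
  simp only [e0, e1]
  simp
  ring

theorem wedge_two_zero (α : Plane [⋀^Fin 2]→L[ℝ] ℝ) (γ : Plane [⋀^Fin 0]→L[ℝ] ℝ)
    (v : Fin (2 + 0) → Plane) (u : Fin 0 → Plane) : wedge α γ v = α v * γ u := by
  have h := sum_perm_two fun σ => ((Equiv.Perm.sign σ : ℤ) : ℝ) *
      (α (fun i => v (σ (Fin.castAdd 0 i))) * γ (fun j => v (σ (Fin.natAdd 2 j))))
  have h0 : α (fun j => v ((1 : Equiv.Perm (Fin 2)) (Fin.castAdd 0 j))) = α v := rfl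
  have h1 : α (fun j => v ((Equiv.swap 0 1 : Equiv.Perm (Fin 2)) (Fin.castAdd 0 j))) = - α v :=
    α.map_swap v (i := 0) (j := 1) (by decide)
  rw [wedge]
  refine (congrArg _ h).trans ?_
  rw [h0, h1, eq_const γ _ u,
    eq_const γ (fun j => v ((Equiv.swap 0 1 : Equiv.Perm (Fin 2)) (Fin.natAdd 2 j))) u,
    Equiv.Perm.sign_one, Equiv.Perm.sign_swap (by decide)]
  simp only [Nat.factorial, Units.val_one, Units.val_neg, Int.cast_neg, Int.cast_one]
  push_cast
  ring

theorem isStar_zero_iff (β : Plane [⋀^Fin 0]→L[ℝ] ℝ) (γ : Plane [⋀^Fin 2]→L[ℝ] ℝ) :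
    IsStar (k := 0) (l := 2) rfl β γ ↔ γ = β 0 • areaForm := by
  constructor
  · intro h
    ext v
    have := h (ContinuousAlternatingMap.constOfIsEmpty ℝ Plane (Fin 0) 1) v
    rw [wedge_zero_two _ _ _ 0, pairing_zero _ _ 0] at this
    simpa using this
  · rintro rfl α v
    rw [wedge_zero_two _ _ _ 0, pairing_zero _ _ 0]
    simp [mul_assoc]

theorem isStar_one_iff (β γ : Plane [⋀^Fin 1]→L[ℝ] ℝ) :
    IsStar (k := 1) (l := 1) rfl β γ ↔ γ = β := by
  have lin : ∀ (α : Plane [⋀^Fin 1]→L[ℝ] ℝ) (u : Plane),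
      α ![u] = u 0 * α ![stdBasis 0] + u 1 * α ![stdBasis 1] := by
    intro α u
    have e : ∀ w : Plane, α ![w] = (ContinuousAlternatingMap.ofSubsingleton ℝ Plane ℝ 0).symm α w := by
      intro w
      simp
      congr 1
      funext i
      fin_cases i
      rfl
    have hu : u = u 0 • stdBasis 0 + u 1 • stdBasis 1 := by
      ext i
      fin_cases i <;> simp [stdBasis]
    rw [e, e, e]
    conv_lhs => rw [hu]
    rw [map_add, map_smul, map_smul, smul_eq_mul, smul_eq_mul]
  constructor
  · intro h
    have key : ∀ u : Plane, γ ![u] = β ![u] := by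
      have h0 := fun α => h α ![stdBasis 0, stdBasis 1]
      simp only [wedge_one_one, pairing_one, areaForm_apply] at h0
      intro u
      rw [lin γ, lin β]
      have d0 := h0 (ContinuousAlternatingMap.ofSubsingleton ℝ Plane ℝ 0
        (ContinuousLinearMap.proj 0))
      have d1 := h0 (ContinuousAlternatingMap.ofSubsingleton ℝ Plane ℝ 0
        (ContinuousLinearMap.proj 1))
      simp [stdBasis] at d0 d1
      simp [stdBasis, d0, d1]
    ext w
    have hw : w = ![w 0] := by
      funext i
      fin_cases i
      rfl
    rw [hw]
    exact key _
  · rintro rfl α v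
    rw [wedge_one_one, pairing_one, areaForm_apply, lin α (v 0), lin α (v 1), lin γ (v 0),
      lin γ (v 1)]
    change _ = _ * (v 0 0 * v 1 1 - v 0 1 * v 1 0)
    ring

theorem isStar_two_iff (β : Plane [⋀^Fin 2]→L[ℝ] ℝ) (γ : Plane [⋀^Fin 0]→L[ℝ] ℝ) :
    IsStar (k := 2) (l := 0) rfl β γ ↔
      γ = ContinuousAlternatingMap.constOfIsEmpty ℝ Plane (Fin 0) (β stdBasis) := by
  have h1 : areaForm stdBasis = 1 := by simp [areaForm_apply, stdBasis]
  constructor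
  · intro h
    ext v
    have := h areaForm stdBasis
    rw [wedge_two_zero _ _ _ v, pairing_two, h1] at this
    change 1 * γ v = 1 * β stdBasis * areaForm stdBasis at this
    rw [h1] at this
    simpa using this
  · rintro rfl α v
    rw [wedge_two_zero _ _ _ 0, pairing_two, alt_two_apply α v]
    simp
    ring_nf

theorem exists_unique_isStar {k l : ℕ} (h : k + l = 2) (β : Plane [⋀^Fin k]→L[ℝ] ℝ) :
    ∃! γ : Plane [⋀^Fin l]→L[ℝ] ℝ, IsStar h β γ := by
  obtain ⟨rfl, rfl⟩ | ⟨rfl, rfl⟩ | ⟨rfl, rfl⟩ :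
      (k = 0 ∧ l = 2) ∨ (k = 1 ∧ l = 1) ∨ (k = 2 ∧ l = 0) := by omega
  · simp only [isStar_zero_iff]
    exact ⟨_, rfl, fun _ e => e⟩
  · simp only [isStar_one_iff]
    exact ⟨_, rfl, fun _ e => e⟩
  · simp only [isStar_two_iff]
    exact ⟨_, rfl, fun _ e => e⟩

/-- The symplectic star operator on covectors. -/
noncomputable def starCovector {k l : ℕ} (h : k + l = 2) :
    (Plane [⋀^Fin k]→L[ℝ] ℝ) →ₗ[ℝ] (Plane [⋀^Fin l]→L[ℝ] ℝ) where
  toFun β := (exists_unique_isStar h β).choose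
  map_add' β β' := by
    refine ((exists_unique_isStar h (β + β')).choose_spec.2 _ fun α v => ?_).symm
    rw [wedge_add, (exists_unique_isStar h β).choose_spec.1 α v,
      (exists_unique_isStar h β').choose_spec.1 α v, pairing_add, add_mul]
  map_smul' c β := by
    refine ((exists_unique_isStar h (c • β)).choose_spec.2 _ fun α v => ?_).symm
    rw [RingHom.id_apply, wedge_smul, (exists_unique_isStar h β).choose_spec.1 α v, pairing_smul,
      mul_assoc]

theorem isStar_starCovector {k l : ℕ} (h : k + l = 2) (β : Plane [⋀^Fin k]→L[ℝ] ℝ) :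
    IsStar h β (starCovector h β) := (exists_unique_isStar h β).choose_spec.1


instance (k : ℕ) : FiniteDimensional ℝ (Plane [⋀^Fin k]→L[ℝ] ℝ) := by
  let f : (Plane [⋀^Fin k]→L[ℝ] ℝ) →ₗ[ℝ] MultilinearMap ℝ (fun _ : Fin k => Plane) ℝ :=
    { toFun := fun γ => γ.toMultilinearMap
      map_add' := fun _ _ => rfl
      map_smul' := fun _ _ => rfl }
  refine FiniteDimensional.of_injective f fun γ γ' h => ?_
  ext v
  exact DFunLike.congr_fun h v

theorem starCovector_comp {k l : ℕ} (h : k + l = 2) (β : Plane [⋀^Fin k]→L[ℝ] ℝ) :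
    (starCovector h β).compContinuousLinearMap linA
      = starCovector h (β.compContinuousLinearMap linA) := by
  have hA : ∀ v : Fin 2 → Plane, areaForm (fun i => linA (v i)) = areaForm v := by
    intro v
    simp [areaForm_apply, linA_apply]
    ring
  have h₁ := isStar_starCovector h β
  have h₂ := isStar_starCovector h (β.compContinuousLinearMap linA)
  obtain ⟨rfl, rfl⟩ | ⟨rfl, rfl⟩ | ⟨rfl, rfl⟩ :
      (k = 0 ∧ l = 2) ∨ (k = 1 ∧ l = 1) ∨ (k = 2 ∧ l = 0) := by omega
  · rw [(isStar_zero_iff _ _).1 h₁, (isStar_zero_iff _ _).1 h₂]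
    ext v
    change β 0 * areaForm (fun i => linA (v i)) = β _ * areaForm v
    rw [hA, eq_const β 0]
  · rw [(isStar_one_iff _ _).1 h₁, (isStar_one_iff _ _).1 h₂]
  · rw [(isStar_two_iff _ _).1 h₁, (isStar_two_iff _ _).1 h₂]
    ext v
    change β stdBasis = β fun i => linA (stdBasis i)
    rw [alt_two_apply β fun i => linA (stdBasis i), hA]
    simp [areaForm_apply, stdBasis]

/-! ### Invariant forms on the transversal and their cohomologies -/

/-- Smooth `k`-forms on the torus `ℝ² / ℤ²`, i.e. `ℤ²`-periodic forms on the plane, that are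
invariant under the holonomy, which is generated by `A`. -/
def transverseForms (k : ℕ) : Submodule ℝ (Plane → Plane [⋀^Fin k]→L[ℝ] ℝ) where
  carrier := {τ | ContDiff ℝ ∞ τ ∧
    (∀ (n : Fin 2 → ℤ) (v : Plane), τ (v + fun i => (n i : ℝ)) = τ v) ∧
    ∀ v : Plane, (τ (linA v)).compContinuousLinearMap linA = τ v}
  zero_mem' := ⟨contDiff_const, fun _ _ => rfl, fun _ => rfl⟩
  add_mem' := by
    rintro τ τ' ⟨h₁, h₂, h₃⟩ ⟨h₁', h₂', h₃'⟩
    refine ⟨h₁.add h₁', fun n v => ?_, fun v => ?_⟩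
    · rw [Pi.add_apply, Pi.add_apply, h₂, h₂']
    · rw [Pi.add_apply τ τ' v, ← h₃ v, ← h₃' v]
      rfl
  smul_mem' := by
    rintro c τ ⟨h₁, h₂, h₃⟩
    refine ⟨contDiff_const.smul h₁, fun n v => ?_, fun v => ?_⟩
    · rw [Pi.smul_apply, Pi.smul_apply, h₂]
    · rw [Pi.smul_apply c τ v, ← h₃ v]
      rfl

/-- The space `Ωᵏ(M/F)`, seen as the space of invariant forms on the transversal. -/
def TransverseForm (k : ℕ) : Type := transverseForms k

noncomputable instance (k : ℕ) : AddCommGroup (TransverseForm k) :=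
  inferInstanceAs (AddCommGroup (transverseForms k))

noncomputable instance (k : ℕ) : Module ℝ (TransverseForm k) :=
  inferInstanceAs (Module ℝ (transverseForms k))

/-- The exterior derivative of invariant forms. -/
noncomputable def dT (k : ℕ) : TransverseForm k →ₗ[ℝ] TransverseForm (k + 1) where
  toFun τ := ⟨extDeriv τ.1, by
    obtain ⟨τ, h₁, h₂, h₃⟩ := τ
    have hd : Differentiable ℝ τ := h₁.differentiable (by simp)
    refine ⟨?_, fun n v => ?_, fun v => ?_⟩
    · exact (ContinuousAlternatingMap.alternatizeUncurryFinCLM ℝ Plane ℝ).contDiff.comp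
        (h₁.fderiv_right (m := ∞) (by simp))
    · have : (fun w => τ (w + fun i => (n i : ℝ))) = τ := funext (h₂ n)
      simp only [extDeriv]
      rw [← fderiv_comp_add_right, this]
    · have h := extDeriv_pullback (f := linA) (x := v) (r := ∞) (hd (linA v))
        linA.contDiff.contDiffAt (by simp; exact WithTop.coe_le_coe.2 le_top)
      simp only [ContinuousLinearMap.fderiv, h₃] at h
      exact h.symm⟩
  map_add' τ τ' := by
    refine Subtype.ext (funext fun v => ?_)
    exact extDeriv_add ((τ.2.1.differentiable (by simp)) v) ((τ'.2.1.differentiable (by simp)) v)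
  map_smul' c τ := by
    refine Subtype.ext (funext fun v => ?_)
    exact extDeriv_smul c τ.1

/-- The symplectic star operator `Ωᵏ → Ω²⁻ᵏ`. -/
noncomputable def starT {k l : ℕ} (h : k + l = 2) : TransverseForm k →ₗ[ℝ] TransverseForm l where
  toFun τ := ⟨fun v => starCovector h (τ.1 v), by
    obtain ⟨τ, h₁, h₂, h₃⟩ := τ
    refine ⟨?_, fun n v => ?_, fun v => ?_⟩
    · exact (LinearMap.toContinuousLinearMap (starCovector h)).contDiff.comp h₁
    · simp only [h₂]
    · rw [starCovector_comp, h₃]⟩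
  map_add' τ τ' := by
    refine Subtype.ext (funext fun v => ?_)
    exact map_add (starCovector h) _ _
  map_smul' c τ := by
    refine Subtype.ext (funext fun v => ?_)
    exact map_smul (starCovector h) _ _

/-- Invariant forms of all degrees; there are none but `0` in degrees above `2`. -/
abbrev TotalForms : Type := (k : ℕ) → TransverseForm k

/-- The exterior derivative on forms of all degrees. -/
noncomputable def dTot : TotalForms →ₗ[ℝ] TotalForms :=
  LinearMap.pi fun k => match k with
    | 0 => 0
    | k + 1 => dT k ∘ₗ LinearMap.proj k

/-- The symplectic star on forms of all degrees, mapping degree `2 - l` to degree `l`. -/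
noncomputable def starTot : TotalForms →ₗ[ℝ] TotalForms :=
  LinearMap.pi fun l =>
    if h : l ≤ 2 then starT (Nat.sub_add_cancel h) ∘ₗ LinearMap.proj (2 - l) else 0

/-- Multiplication by `(-1) ^ (k + 1)` in degree `k`. -/
noncomputable def signTot : TotalForms →ₗ[ℝ] TotalForms :=
  LinearMap.pi fun k => (-1 : ℝ) ^ (k + 1) • LinearMap.proj k

/-- The operator `d^Λ α = (-1) ^ (k + 1) ⋆ d ⋆ α` for `α` of degree `k`. -/
noncomputable def dLambda : TotalForms →ₗ[ℝ] TotalForms :=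
  starTot ∘ₗ dTot ∘ₗ starTot ∘ₗ signTot

/-- The degree `k` part of a space of forms. -/
noncomputable def degreePart (S : Submodule ℝ TotalForms) (k : ℕ) : Submodule ℝ (TransverseForm k) :=
  S.comap (LinearMap.single ℝ TransverseForm k)

/-- The degree `k` part of the quotient `Z / B`. -/
abbrev Cohomology (Z B : Submodule ℝ TotalForms) (k : ℕ) : Type :=
  degreePart Z k ⧸ (degreePart B k).submoduleOf (degreePart Z k)

/-- Basic cohomology `ker d / im d`. -/
abbrev HBasic (k : ℕ) : Type := Cohomology (LinearMap.ker dTot) (LinearMap.range dTot) k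

/-- The cohomology `ker (d + d^Λ) / im (d d^Λ)`. -/
abbrev HSum (k : ℕ) : Type :=
  Cohomology (LinearMap.ker (dTot + dLambda)) (LinearMap.range (dTot ∘ₗ dLambda)) k

/-- The cohomology `ker (d d^Λ) / (im d + im d^Λ)`. -/
abbrev HProd (k : ℕ) : Type :=
  Cohomology (LinearMap.ker (dTot ∘ₗ dLambda)) (LinearMap.range dTot ⊔ LinearMap.range dLambda) k

end Sympl

/-! ### Smooth functions on the circle, coordinate forms, and the comparison with forms on `M` -/

/-- `C^∞(S¹)`. -/
abbrev SmoothCircle : Type := C^∞⟮𝓡 1, Circle; 𝓘(ℝ, ℝ), ℝ⟯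

/-- The point of the circle with coordinate `y ∈ ℝ/ℤ`. -/
noncomputable def circlePoint (y : ℝ) : Circle := Circle.exp (2 * Real.pi * y)

/-- The covector `dy`. -/
noncomputable def dy : Plane [⋀^Fin 1]→L[ℝ] ℝ :=
  ContinuousAlternatingMap.ofSubsingleton ℝ Plane ℝ 0 (ContinuousLinearMap.proj 1)

/-- A number as a covector of degree `0`. -/
noncomputable def scalar (c : ℝ) : Plane [⋀^Fin 0]→L[ℝ] ℝ :=
  ContinuousAlternatingMap.constOfIsEmpty ℝ Plane (Fin 0) c

/-- The form `α` on `M` corresponds to the form `τ` on the transversal: their pullbacks to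
`Space`, along the covering map and along the projection `(t, s) ↦ t`, agree. -/
def Corresponds {k : ℕ} (α : DiffForm Space M k) (τ : TransverseForm k) : Prop :=
  ∀ (p : Space) (w : Fin k → Space),
    α (proj p) (fun i => mfderiv 𝓘(ℝ, Space) 𝓘(ℝ, Space) proj p (w i)) =
      τ.1 p.1 (fun i => (w i).1)

end Suspension

/-!
Pulled back along `q`, a basic form on `M` does not depend on the coordinate `s`, by Cartan's
formula, so it is an `A`-invariant form on the torus. On a circle of irrational height `y` the map
`A` is the irrational rotation `x ↦ x + y`, hence a continuous `A`-invariant function depends on `y`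
alone. An invariant `1`-form `a dx + b dy` satisfies `b (x + y, y) = b (x, y) - a (y)`, and averaging
over `x` gives `a = 0`. The complex of basic forms is therefore `C^∞(S¹)` in the degrees `0`, `1`
and `2`, with `d (f, g, h) = (0, f', 0)` and `d^Λ (f, g, h) = (0, -h', 0)`. All the cohomologies are
determined by the kernel and the image of `f ↦ f'`, namely the constant functions and the functions
of mean zero.
-/

namespace Suspension

section General

theorem finite_range_of_isIntegral {X K : Type*} [CommRing K] [IsDomain K] {f : X → K}
    (hf : IsIntegral K f) : (Set.range f).Finite := by
  obtain ⟨p, hp, hroot⟩ := hf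
  refine (Polynomial.finite_setOfPred_isRoot hp.ne_zero).subset ?_
  rintro _ ⟨x, rfl⟩
  have h := Polynomial.aeval_algHom_apply (Pi.evalAlgHom K (fun _ => K) x) f p
  rw [Polynomial.aeval_def f, hroot, map_zero] at h
  exact h

theorem contDiff_integral_of_contDiff {E : Type*} [NormedAddCommGroup E] [NormedSpace ℝ E]
    [CompleteSpace E] {g : ℝ → E} (hg : ContDiff ℝ ∞ g) (a : ℝ) :
    ContDiff ℝ ∞ fun y => ∫ r in a..y, g r := by
  have hderiv (y : ℝ) := (hg.continuous.integral_hasStrictDerivAt a y).hasDerivAt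
  refine contDiff_infty_iff_deriv.2 ⟨fun y => (hderiv y).differentiableAt, ?_⟩
  rwa [funext fun y => (hderiv y).deriv]

theorem apply_eq_of_periodic_of_dense_closure {G X : Type*} [TopologicalSpace G] [AddCommGroup G]
    [ContinuousAdd G] [TopologicalSpace X] [T2Space X] {f : G → X} (hf : Continuous f) {s : Set G}
    (hs : Dense (AddSubgroup.closure s : Set G)) (hper : ∀ c ∈ s, Function.Periodic f c) (x y : G) :
    f x = f y := by
  have hclosure (c : G) (hc : c ∈ AddSubgroup.closure s) : f (x + c) = f x := by
    suffices Function.Periodic f c from this x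
    induction hc using AddSubgroup.closure_induction with
    | mem c hc => exact hper c hc
    | zero => exact fun _ => by rw [add_zero]
    | add c d _ _ hc hd => exact hc.add_period hd
    | neg c _ hc => exact hc.neg
  have hconst : (fun c => f (x + c)) = fun _ => f x :=
    Continuous.ext_on hs (hf.comp (continuous_const_add x)) continuous_const hclosure
  simpa only [add_sub_cancel] using (congrFun hconst (y - x)).symm

theorem eq_zero_of_apply_add_eq_add {E : Type*} [NormedAddCommGroup E] [NormedSpace ℝ E]
    [CompleteSpace E] {b : ℝ → E} (hb : Continuous b) {T : ℝ} (hT : T ≠ 0)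
    (hper : Function.Periodic b T) {y : ℝ} {c : E} (h : ∀ x, b (x + y) = b x + c) : c = 0 := by
  have hmean : ∫ x in (0 : ℝ)..T, b (x + y) = ∫ x in (0 : ℝ)..T, b x := by
    rw [intervalIntegral.integral_comp_add_right, zero_add, add_comm T,
      hper.intervalIntegral_add_eq y 0, zero_add]
  simp_rw [h] at hmean
  rw [intervalIntegral.integral_add (hb.intervalIntegrable _ _) intervalIntegrable_const,
    intervalIntegral.integral_const, sub_zero, add_eq_left, smul_eq_zero] at hmean
  exact hmean.resolve_left hT

end General

section CircleFunctions

theorem circlePoint_add (x y : ℝ) : circlePoint (x + y) = circlePoint x * circlePoint y := by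
  rw [circlePoint, mul_add, Circle.exp_add, circlePoint, circlePoint]

theorem circlePoint_eq_one_iff {y : ℝ} : circlePoint y = 1 ↔ ∃ n : ℤ, y = n := by
  rw [circlePoint, Circle.exp_eq_one]
  refine exists_congr fun n => ?_
  rw [mul_comm (n : ℝ), mul_right_inj' Real.two_pi_pos.ne']

theorem circlePoint_periodic : Function.Periodic circlePoint 1 := fun y => by
  rw [circlePoint_add, circlePoint_eq_one_iff.2 ⟨1, Int.cast_one.symm⟩, mul_one]

theorem circlePoint_arg (z : Circle) : circlePoint (Complex.arg z / (2 * Real.pi)) = z := by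
  rw [circlePoint, mul_div_cancel₀ _ Real.two_pi_pos.ne', Circle.exp_arg]

theorem circlePoint_surjective : Function.Surjective circlePoint := fun z => ⟨_, circlePoint_arg z⟩

theorem factorsThrough_circlePoint {X : Type*} {g : ℝ → X} (hg : Function.Periodic g 1) :
    Function.FactorsThrough g circlePoint := by
  intro x y hxy
  obtain ⟨n, hn⟩ := circlePoint_eq_one_iff.1 (show circlePoint (x - y) = 1 by
    rw [← mul_left_inj (circlePoint y), ← circlePoint_add, sub_add_cancel, hxy, one_mul])
  rw [eq_add_of_sub_eq' hn]
  simpa only [mul_one] using hg.int_mul n y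

theorem contMDiff_circlePoint {n : WithTop ℕ∞} : ContMDiff 𝓘(ℝ, ℝ) (𝓡 1) n circlePoint :=
  contMDiff_circleExp.comp (contDiff_const.mul contDiff_id).contMDiff

theorem contMDiff_circle_coe {n : WithTop ℕ∞} :
    ContMDiff (𝓡 1) 𝓘(ℝ, ℂ) n fun z : Circle => (z : ℂ) :=
  haveI : Fact (Module.finrank ℝ ℂ = 1 + 1) := ⟨Complex.finrank_real_complex⟩
  contMDiff_coe_sphere

theorem contDiffAt_arg {n : WithTop ℕ∞} {z : ℂ} (hz : z ∈ Complex.slitPlane) :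
    ContDiffAt ℝ n Complex.arg z := by
  have h : ContDiffAt ℝ n (fun w => (Complex.log w).im) z :=
    Complex.imCLM.contDiff.contDiffAt.comp z ((Complex.contDiffAt_log hz).restrict_scalars ℝ)
  simpa only [Complex.log_im] using h

theorem exists_contMDiffAt_section_circlePoint (n : WithTop ℕ∞) (z₀ : Circle) :
    ∃ s : Circle → ℝ, ContMDiffAt (𝓡 1) 𝓘(ℝ, ℝ) n s z₀ ∧ ∀ z, circlePoint (s z) = z := by
  obtain ⟨y₀, rfl⟩ := circlePoint_surjective z₀
  refine ⟨fun z => Complex.arg (z / circlePoint y₀ : Circle) / (2 * Real.pi) + y₀, ?_, fun z => ?_⟩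
  · have harg : ContDiffAt ℝ n (fun w : ℂ => Complex.arg (w / circlePoint y₀) / (2 * Real.pi) + y₀)
        (circlePoint y₀ : ℂ) := by
      refine ((ContDiffAt.comp _ (contDiffAt_arg ?_) (contDiffAt_id.div_const _)).div_const
        _).add contDiffAt_const
      rw [id, div_self (Circle.coe_ne_zero _)]
      exact Complex.one_mem_slitPlane
    simp only [Circle.coe_div]
    exact harg.contMDiffAt.comp _ contMDiff_circle_coe.contMDiffAt
  · rw [circlePoint_add, circlePoint_arg, div_mul_cancel]

theorem contMDiff_comp_circlePoint_iff {E H N : Type*} [NormedAddCommGroup E] [NormedSpace ℝ E]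
    [TopologicalSpace H] {I : ModelWithCorners ℝ E H} [TopologicalSpace N] [ChartedSpace H N]
    {n : WithTop ℕ∞} {f : Circle → N} :
    ContMDiff 𝓘(ℝ, ℝ) I n (f ∘ circlePoint) ↔ ContMDiff (𝓡 1) I n f := by
  refine ⟨fun h z => ?_, fun h => h.comp contMDiff_circlePoint⟩
  obtain ⟨s, hs, hsec⟩ := exists_contMDiffAt_section_circlePoint n z
  have hf : f = (f ∘ circlePoint) ∘ s := funext fun w => (congrArg f (hsec w)).symm
  rw [hf]
  exact h.contMDiffAt.comp z hs

namespace SmoothCircle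

theorem contDiff_comp_circlePoint (f : SmoothCircle) :
    ContDiff ℝ ∞ fun y => f (circlePoint y) :=
  (f.contMDiff.comp contMDiff_circlePoint).contDiff

theorem continuous_comp_circlePoint (f : SmoothCircle) : Continuous fun y => f (circlePoint y) :=
  f.contDiff_comp_circlePoint.continuous

theorem differentiable_comp_circlePoint (f : SmoothCircle) :
    Differentiable ℝ fun y => f (circlePoint y) :=
  f.contDiff_comp_circlePoint.differentiable (by simp)

theorem ext_circlePoint {f g : SmoothCircle} (h : ∀ y, f (circlePoint y) = g (circlePoint y)) :
    f = g :=
  DFunLike.coe_injective (circlePoint_surjective.injective_comp_right (funext h))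

theorem exists_comp_circlePoint_eq {g : ℝ → ℝ} (hg : ContDiff ℝ ∞ g)
    (hp : Function.Periodic g 1) : ∃ f : SmoothCircle, ∀ y, f (circlePoint y) = g y := by
  have hfactors := factorsThrough_circlePoint hp
  refine ⟨⟨Function.extend circlePoint g 0, contMDiff_comp_circlePoint_iff.1 ?_⟩,
    hfactors.extend_apply 0⟩
  rw [hfactors.extend_comp]
  exact hg.contMDiff

theorem not_finiteDimensional : ¬ FiniteDimensional ℝ SmoothCircle := by
  intro _
  let re : SmoothCircle :=
    ⟨fun z => (z : ℂ).re, Complex.reCLM.contDiff.contMDiff.comp contMDiff_circle_coe⟩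
  have hfin : (Set.range re).Finite := finite_range_of_isIntegral
    ((Algebra.IsIntegral.isIntegral re).map (ContMDiffMap.coeFnAlgHom (𝕜 := ℝ)))
  refine Set.Icc_infinite (show (-1 : ℝ) < 1 by norm_num) (hfin.subset fun x hx => ?_)
  refine ⟨Circle.exp (Real.arccos x), ?_⟩
  change (Circle.exp (Real.arccos x) : ℂ).re = x
  rw [Circle.coe_exp, Complex.exp_ofReal_mul_I_re, Real.cos_arccos hx.1 hx.2]

theorem exists_hasDerivAt_comp_circlePoint (f : SmoothCircle) :
    ∃ f' : SmoothCircle, ∀ y, HasDerivAt (fun y => f (circlePoint y)) (f' (circlePoint y)) y := by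
  obtain ⟨f', hf'⟩ := exists_comp_circlePoint_eq (g := deriv fun y => f (circlePoint y))
    (contDiff_infty_iff_deriv.1 f.contDiff_comp_circlePoint).2 fun y => by
      rw [← deriv_comp_add_const]
      exact congrArg (deriv · y) (funext (circlePoint_periodic.comp f))
  exact ⟨f', fun y => hf' y ▸ (f.differentiable_comp_circlePoint y).hasDerivAt⟩

/-- The derivative of a function on `ℝ/ℤ`. -/
noncomputable def derivative : SmoothCircle →ₗ[ℝ] SmoothCircle where
  toFun f := f.exists_hasDerivAt_comp_circlePoint.choose
  map_add' f g := ext_circlePoint fun y =>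
    ((f + g).exists_hasDerivAt_comp_circlePoint.choose_spec y).unique
      ((f.exists_hasDerivAt_comp_circlePoint.choose_spec y).add
        (g.exists_hasDerivAt_comp_circlePoint.choose_spec y))
  map_smul' c f := ext_circlePoint fun y =>
    ((c • f).exists_hasDerivAt_comp_circlePoint.choose_spec y).unique
      ((f.exists_hasDerivAt_comp_circlePoint.choose_spec y).const_smul c)

theorem hasDerivAt_comp_circlePoint (f : SmoothCircle) (y : ℝ) :
    HasDerivAt (fun y => f (circlePoint y)) (derivative f (circlePoint y)) y :=
  f.exists_hasDerivAt_comp_circlePoint.choose_spec y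

theorem eq_derivative_iff {f g : SmoothCircle} :
    g = derivative f ↔ ∀ y, HasDerivAt (fun y => f (circlePoint y)) (g (circlePoint y)) y :=
  ⟨fun h => h ▸ f.hasDerivAt_comp_circlePoint, fun h =>
    ext_circlePoint fun y => (h y).unique (f.hasDerivAt_comp_circlePoint y)⟩

theorem derivative_eq_zero_iff {f : SmoothCircle} : derivative f = 0 ↔ ∀ z w, f z = f w := by
  constructor
  · intro h
    have hderiv (y : ℝ) : deriv (fun y => f (circlePoint y)) y = 0 := by
      rw [(f.hasDerivAt_comp_circlePoint y).deriv, h, ContMDiffMap.coe_zero, Pi.zero_apply]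
    exact circlePoint_surjective.forall₂.2
      (is_const_of_deriv_eq_zero f.differentiable_comp_circlePoint hderiv)
  · intro h
    refine (eq_derivative_iff.2 fun y => ?_).symm
    simp only [h _ 1]
    exact hasDerivAt_const _ _

/-- The mean value of a function on `ℝ/ℤ`. -/
noncomputable def mean : SmoothCircle →ₗ[ℝ] ℝ where
  toFun f := ∫ y in (0 : ℝ)..1, f (circlePoint y)
  map_add' f g := intervalIntegral.integral_add
    (f.continuous_comp_circlePoint.intervalIntegrable _ _)
    (g.continuous_comp_circlePoint.intervalIntegrable _ _)
  map_smul' c f := intervalIntegral.integral_const_mul c fun y => f (circlePoint y)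

theorem mean_apply (f : SmoothCircle) : mean f = ∫ y in (0 : ℝ)..1, f (circlePoint y) := rfl

theorem mean_derivative (f : SmoothCircle) : mean (derivative f) = 0 := by
  rw [mean_apply, intervalIntegral.integral_eq_sub_of_hasDerivAt
    (fun y _ => f.hasDerivAt_comp_circlePoint y)
    ((derivative f).continuous_comp_circlePoint.intervalIntegrable _ _),
    circlePoint_periodic.eq, sub_self]

theorem exists_derivative_eq_of_mean_eq_zero {f : SmoothCircle} (hf : mean f = 0) :
    ∃ F, derivative F = f := by
  have hp : Function.Periodic (fun y => f (circlePoint y)) 1 := circlePoint_periodic.comp f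
  have hint (a b : ℝ) := f.continuous_comp_circlePoint.intervalIntegrable
    (μ := MeasureTheory.volume) a b
  obtain ⟨F, hF⟩ := exists_comp_circlePoint_eq (g := fun y => ∫ r in (0 : ℝ)..y, f (circlePoint r))
    (contDiff_integral_of_contDiff f.contDiff_comp_circlePoint 0) fun y => by
      beta_reduce
      rw [hp.intervalIntegral_add_eq_add 0 y hint, zero_add, ← mean_apply, hf, add_zero]
  refine ⟨F, (eq_derivative_iff.2 fun y => ?_).symm⟩
  simp_rw [hF]
  exact (f.continuous_comp_circlePoint.integral_hasStrictDerivAt 0 y).hasDerivAt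

end SmoothCircle

end CircleFunctions

section InvariantForms

theorem eq_of_linA_invariant {X : Type*} [TopologicalSpace X] [T2Space X] {g : Plane → X}
    (hg : Continuous g) (hper : ∀ y, Function.Periodic (fun x => g ![x, y]) 1)
    (hA : ∀ v, g (linA v) = g v) (x x' y : ℝ) : g ![x, y] = g ![x', y] := by
  have hirr (y : ℝ) (hy : Irrational y) : g ![x, y] = g ![x', y] := by
    refine apply_eq_of_periodic_of_dense_closure (f := fun x => g ![x, y]) (s := {y, 1})
      (by fun_prop) (dense_addSubgroupClosure_pair_iff.2 (by rwa [div_one])) ?_ x x'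
    rintro c (rfl | rfl)
    · exact fun x => by simpa [linA_apply] using hA ![x, c]
    · exact hper y
  exact congrFun (Continuous.ext_on dense_irrational (f := fun y => g ![x, y])
    (g := fun y => g ![x', y]) (by fun_prop) (by fun_prop) hirr) y

theorem plane_eta (v : Plane) : ![v 0, v 1] = v := by
  ext i
  fin_cases i <;> rfl

theorem exists_smoothCircle_of_linA_invariant {g : Plane → ℝ} (hg : ContDiff ℝ ∞ g)
    (hper : ∀ (m n : ℤ) v, g (v + ![(m : ℝ), (n : ℝ)]) = g v) (hA : ∀ v, g (linA v) = g v) :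
    ∃ f : SmoothCircle, ∀ v, f (circlePoint (v 1)) = g v := by
  have hper₀ (y : ℝ) : Function.Periodic (fun x => g ![x, y]) 1 := fun x => by
    simpa using hper 1 0 ![x, y]
  have hper₁ : Function.Periodic (fun y => g ![0, y]) 1 := fun y => by
    simpa using hper 0 1 ![0, y]
  have hline : ContDiff ℝ ∞ fun y : ℝ => (![0, y] : Plane) :=
    contDiff_pi.2 (Fin.forall_fin_two.2 ⟨contDiff_const, contDiff_id⟩)
  obtain ⟨f, hf⟩ := SmoothCircle.exists_comp_circlePoint_eq (hg.comp hline) hper₁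
  refine ⟨f, fun v => ?_⟩
  rw [hf, Function.comp_apply, eq_of_linA_invariant hg.continuous hper₀ hA 0 (v 0), plane_eta]

theorem covector_ext {k : ℕ} {γ γ' : Plane [⋀^Fin k]→L[ℝ] ℝ}
    (h : ∀ i : Fin k → Fin 2, Function.Injective i →
      γ (fun j => stdBasis (i j)) = γ' fun j => stdBasis (i j)) : γ = γ' := by
  refine ContinuousAlternatingMap.toAlternatingMap_injective
    ((Pi.basisFun ℝ (Fin 2)).ext_alternating fun i hi => ?_)
  simp only [Pi.basisFun_apply]
  exact h i hi

theorem subsingleton_transverseForm {k : ℕ} (hk : 3 ≤ k) : Subsingleton (TransverseForm k) := by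
  refine ⟨fun τ τ' => Subtype.ext (funext fun v => covector_ext fun i hi => ?_)⟩
  have hcard : k ≤ 2 := by simpa only [Fintype.card_fin] using Fintype.card_le_of_injective i hi
  omega

namespace TransverseForm
variable {k : ℕ}

theorem contDiff_apply (τ : TransverseForm k) (w : Fin k → Plane) :
    ContDiff ℝ ∞ fun v => τ.1 v w :=
  (ContinuousAlternatingMap.apply ℝ Plane ℝ w).contDiff.comp τ.2.1

theorem apply_add_intCast (τ : TransverseForm k) (m n : ℤ) (v : Plane) :
    τ.1 (v + ![(m : ℝ), (n : ℝ)]) = τ.1 v := by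
  have h : (fun i => ((![m, n] i : ℤ) : ℝ)) = ![(m : ℝ), (n : ℝ)] := by
    ext i
    fin_cases i <;> rfl
  exact h ▸ τ.2.2.1 ![m, n] v

theorem apply_linA (τ : TransverseForm k) (v : Plane) (w : Fin k → Plane) :
    τ.1 (linA v) (fun i => linA (w i)) = τ.1 v w :=
  DFunLike.congr_fun (τ.2.2.2 v) w

end TransverseForm

theorem linA_stdBasis_zero : linA (stdBasis 0) = stdBasis 0 := by
  ext i
  fin_cases i <;> simp [linA_apply, stdBasis]

theorem linA_stdBasis_one : linA (stdBasis 1) = stdBasis 0 + stdBasis 1 := by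
  ext i
  fin_cases i <;> simp [linA_apply, stdBasis]

theorem oneForm_add {E F : Type*} [NormedAddCommGroup E] [NormedSpace ℝ E] [NormedAddCommGroup F]
    [NormedSpace ℝ F] (γ : E [⋀^Fin 1]→L[ℝ] F) (u v : E) :
    γ (fun _ => u + v) = γ (fun _ => u) + γ fun _ => v :=
  map_add ((ContinuousAlternatingMap.ofSubsingleton ℝ E F 0).symm γ) u v

theorem TransverseForm.apply_stdBasis_zero (τ : TransverseForm 1) (v : Plane) :
    τ.1 v (fun _ => stdBasis 0) = 0 := by
  have hA₀ (v : Plane) : τ.1 (linA v) (fun _ => stdBasis 0) = τ.1 v fun _ => stdBasis 0 := by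
    rw [← τ.apply_linA v, linA_stdBasis_zero]
  have hA₁ (v : Plane) : τ.1 (linA v) (fun _ => stdBasis 1) =
      τ.1 v (fun _ => stdBasis 1) + -τ.1 v fun _ => stdBasis 0 := by
    rw [← τ.apply_linA v, linA_stdBasis_one, oneForm_add, hA₀]
    ring
  have hper (i : Fin 2) (y : ℝ) :
      Function.Periodic (fun x => τ.1 ![x, y] fun _ => stdBasis i) 1 := fun x => by
    simpa using DFunLike.congr_fun (τ.apply_add_intCast 1 0 ![x, y]) fun _ => stdBasis i
  have hcont (i : Fin 2) : Continuous fun v => τ.1 v fun _ => stdBasis i :=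
    (τ.contDiff_apply _).continuous
  have hx (x : ℝ) : τ.1 ![x, v 1] (fun _ => stdBasis 0) = τ.1 v fun _ => stdBasis 0 := by
    rw [eq_of_linA_invariant (hcont 0) (hper 0) hA₀ x (v 0), plane_eta]
  refine neg_eq_zero.1 (eq_zero_of_apply_add_eq_add
    (b := fun x => τ.1 ![x, v 1] fun _ => stdBasis 1) (y := v 1)
    ((hcont 1).comp (by fun_prop)) one_ne_zero (hper 1 (v 1)) fun x => ?_)
  simpa [linA_apply, hx] using hA₁ ![x, v 1]

end InvariantForms

section Coefficients

theorem dy_comp_linA : dy.compContinuousLinearMap linA = dy := by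
  ext v
  change (linA (v 0)) 1 = v 0 1
  simp [linA_apply]

theorem areaForm_comp_linA : areaForm.compContinuousLinearMap linA = areaForm := by
  ext v
  change areaForm (fun i => linA (v i)) = areaForm v
  simp [areaForm_apply, linA_apply]
  ring

theorem dy_stdBasis_zero : dy (fun _ => stdBasis 0) = 0 := by
  change stdBasis 0 1 = 0
  simp [stdBasis]

theorem dy_stdBasis_one : dy (fun _ => stdBasis 1) = 1 := by
  change stdBasis 1 1 = 1
  simp [stdBasis]

theorem areaForm_stdBasis : areaForm stdBasis = 1 := by
  simp [areaForm_apply, stdBasis]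

variable {k : ℕ} {c : Plane [⋀^Fin k]→L[ℝ] ℝ} {u : Fin k → Plane}

/-- The invariant form `f(y) c`, for an `A`-invariant covector `c`. -/
noncomputable def smulCovector (hc : c.compContinuousLinearMap linA = c) :
    SmoothCircle →ₗ[ℝ] TransverseForm k where
  toFun f := ⟨fun v => f (circlePoint (v 1)) • c, by
    refine ⟨?_, fun n v => ?_, fun v => ?_⟩
    · exact (f.contDiff_comp_circlePoint.comp (contDiff_apply ℝ ℝ 1)).smul contDiff_const
    · simpa using congrArg (f · • c) (circlePoint_periodic.int_mul (n 1) (v 1))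
    · rw [linA_apply]
      exact congrArg (f (circlePoint (v 1)) • ·) hc⟩
  map_add' f g := Subtype.ext (funext fun v => add_smul (f (circlePoint (v 1))) _ c)
  map_smul' a f := Subtype.ext (funext fun v => mul_smul a (f (circlePoint (v 1))) c)

theorem smulCovector_injective (hc : c.compContinuousLinearMap linA = c) (hu : c u = 1) :
    Function.Injective (smulCovector hc) := fun f g hfg =>
  SmoothCircle.ext_circlePoint fun y => by
    have h : f (circlePoint y) * c u = g (circlePoint y) * c u :=
      DFunLike.congr_fun (congrFun (congrArg Subtype.val hfg) ![0, y]) u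
    rwa [hu, mul_one, mul_one] at h

theorem smulCovector_surjective (hc : c.compContinuousLinearMap linA = c) (hu : c u = 1)
    (hspan : ∀ (τ : TransverseForm k) v, τ.1 v = τ.1 v u • c) :
    Function.Surjective (smulCovector hc) := fun τ => by
  have hA (v : Plane) : τ.1 (linA v) u = τ.1 v u := by
    have h : (τ.1 (linA v)).compContinuousLinearMap linA = τ.1 v := τ.2.2.2 v
    rw [hspan τ (linA v)] at h
    have h : τ.1 (linA v) u * c.compContinuousLinearMap linA u = τ.1 v u := DFunLike.congr_fun h u
    rwa [hc, hu, mul_one] at h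
  obtain ⟨f, hf⟩ := exists_smoothCircle_of_linA_invariant (τ.contDiff_apply u)
    (fun m n v => by rw [τ.apply_add_intCast]) hA
  exact ⟨f, Subtype.ext (funext fun v => (congrArg (· • c) (hf v)).trans (hspan τ v).symm)⟩

/-- The coefficient `f` of an invariant form `f(y) c`, where `c` is an `A`-invariant covector that
spans the values of all invariant forms. -/
noncomputable def coeff (hc : c.compContinuousLinearMap linA = c) (hu : c u = 1)
    (hspan : ∀ (τ : TransverseForm k) v, τ.1 v = τ.1 v u • c) :
    TransverseForm k ≃ₗ[ℝ] SmoothCircle :=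
  (LinearEquiv.ofBijective (smulCovector hc)
    ⟨smulCovector_injective hc hu, smulCovector_surjective hc hu hspan⟩).symm

theorem apply_eq_coeff_smul (hc : c.compContinuousLinearMap linA = c) (hu : c u = 1)
    (hspan : ∀ (τ : TransverseForm k) v, τ.1 v = τ.1 v u • c) (τ : TransverseForm k) (v : Plane) :
    τ.1 v = coeff hc hu hspan τ (circlePoint (v 1)) • c :=
  congrFun (congrArg Subtype.val ((coeff hc hu hspan).symm_apply_apply τ).symm) v

theorem zeroForm_eq_smul (β : Plane [⋀^Fin 0]→L[ℝ] ℝ) : β = β 0 • scalar 1 := by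
  ext w
  rw [eq_const β w 0]
  exact (mul_one (β 0)).symm

theorem twoForm_eq_smul (β : Plane [⋀^Fin 2]→L[ℝ] ℝ) : β = β stdBasis • areaForm :=
  ContinuousAlternatingMap.ext fun v => alt_two_apply β v

theorem TransverseForm.apply_eq_smul_dy (τ : TransverseForm 1) (v : Plane) :
    τ.1 v = τ.1 v (fun _ => stdBasis 1) • dy := by
  refine covector_ext fun i _ => ?_
  obtain ⟨j, rfl⟩ : ∃ j, i = fun _ => j := ⟨i 0, funext fun l => congrArg i (Subsingleton.elim l 0)⟩
  rw [ContinuousAlternatingMap.smul_apply]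
  fin_cases j
  · exact (τ.apply_stdBasis_zero v).trans (by simp [dy_stdBasis_zero])
  · simp [dy_stdBasis_one]

/-- The coefficient `f` of an invariant form `f(y)` of degree `0`. -/
noncomputable def coeffZero : TransverseForm 0 ≃ₗ[ℝ] SmoothCircle :=
  coeff (c := scalar 1) (u := 0) rfl rfl fun τ v => zeroForm_eq_smul (τ.1 v)

/-- The coefficient `f` of an invariant form `f(y) dy`. -/
noncomputable def coeffOne : TransverseForm 1 ≃ₗ[ℝ] SmoothCircle :=
  coeff dy_comp_linA dy_stdBasis_one TransverseForm.apply_eq_smul_dy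

/-- The coefficient `f` of an invariant form `f(y) dx ∧ dy`. -/
noncomputable def coeffTwo : TransverseForm 2 ≃ₗ[ℝ] SmoothCircle :=
  coeff areaForm_comp_linA areaForm_stdBasis fun τ v => twoForm_eq_smul (τ.1 v)

theorem apply_eq_scalar_coeffZero (τ : TransverseForm 0) (v : Plane) :
    τ.1 v = scalar (coeffZero τ (circlePoint (v 1))) :=
  (apply_eq_coeff_smul ..).trans (zeroForm_eq_smul (scalar _)).symm

theorem apply_eq_coeffOne_smul_dy (τ : TransverseForm 1) (v : Plane) :
    τ.1 v = coeffOne τ (circlePoint (v 1)) • dy :=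
  apply_eq_coeff_smul ..

theorem apply_eq_coeffTwo_smul_areaForm (τ : TransverseForm 2) (v : Plane) :
    τ.1 v = coeffTwo τ (circlePoint (v 1)) • areaForm :=
  apply_eq_coeff_smul ..

theorem areaForm_mem_transverseForms : (fun _ => areaForm) ∈ transverseForms 2 :=
  ⟨contDiff_const, fun _ _ => rfl, fun _ => areaForm_comp_linA⟩

theorem extDeriv_const {E F : Type*} [NormedAddCommGroup E] [NormedSpace ℝ E]
    [NormedAddCommGroup F] [NormedSpace ℝ F] {n : ℕ} (c : E [⋀^Fin n]→L[ℝ] F) :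
    extDeriv (fun _ : E => c) = 0 := by
  funext v
  rw [extDeriv, fderiv_fun_const]
  exact map_zero (ContinuousAlternatingMap.alternatizeUncurryFinCLM ℝ E F)

theorem exists_areaForm_ne_zero {u : Plane} (hu : u ≠ 0) : ∃ w, areaForm ![u, w] ≠ 0 := by
  by_contra! h
  have h₀ : u 1 = 0 := by simpa [areaForm_apply, stdBasis] using h (stdBasis 0)
  have h₁ : u 0 = 0 := by simpa [areaForm_apply, stdBasis] using h (stdBasis 1)
  exact hu (funext (Fin.forall_fin_two.2 ⟨h₁, h₀⟩))

end Coefficients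

section Covering

theorem shear_zero : shear 0 = ContinuousLinearMap.id ℝ Plane := by
  ext v i
  fin_cases i <;> simp [shear_apply]

/-- The linear part of a deck transformation `(m, n, k)`. -/
noncomputable def deckLin (k : ℤ) : Space →L[ℝ] Space :=
  (shear k).prodMap (ContinuousLinearMap.id ℝ ℝ)

theorem deckLin_apply (k : ℤ) (w : Space) : deckLin k w = (shear k w.1, w.2) := rfl

theorem deckLin_zero : deckLin 0 = ContinuousLinearMap.id ℝ Space := by
  rw [deckLin, shear_zero]
  rfl

theorem deckLin_add (k l : ℤ) : deckLin (k + l) = (deckLin k).comp (deckLin l) :=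
  ContinuousLinearMap.ext fun w => Prod.ext (shear_add k l w.1) rfl

theorem contDiff_deck_smul {n : WithTop ℕ∞} (g : Deck) : ContDiff ℝ n fun w : Space => g • w := by
  simp only [Deck.smul_def]
  fun_prop

theorem hasFDerivAt_deck_smul (g : Deck) (p : Space) :
    HasFDerivAt (fun w : Space => g • w) (deckLin g.k) p := by
  simp only [Deck.smul_def]
  exact (((shear g.k).hasFDerivAt.comp p hasFDerivAt_fst).add_const _).prodMk
    (hasFDerivAt_snd.add_const _)

theorem chartAt_symm_eq_proj (x : M) : ((chartAt Space x).symm : Space → M) = proj :=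
  symm_eq_proj (chart_mem_atlas Space x)

/-- The lift of a point of `M` that its preferred chart selects. -/
noncomputable def basePoint (x : M) : Space := chartAt Space x x

theorem proj_basePoint (x : M) : proj (basePoint x) = x := by
  rw [← chartAt_symm_eq_proj x]
  exact (chartAt Space x).left_inv (mem_chart_source Space x)

theorem exists_smul_eq_basePoint (p : Space) : ∃ g : Deck, g • p = basePoint (proj p) :=
  exists_smul_of_proj_eq (proj_basePoint (proj p)).symm

theorem smul_mem_chart_target {p : Space} {g : Deck} (hg : g • p = basePoint (proj p)) :
    g • p ∈ (chartAt Space (proj p)).target :=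
  hg ▸ mem_chart_target Space (proj p)

theorem chartAt_comp_proj_eventuallyEq {p : Space} {g : Deck} (hg : g • p = basePoint (proj p)) :
    (fun w => chartAt Space (proj p) (proj w)) =ᶠ[𝓝 p] fun w => g • w := by
  filter_upwards [(contDiff_deck_smul (n := 0) g).continuous.continuousAt.eventually_mem
    ((chartAt Space (proj p)).open_target.mem_nhds (smul_mem_chart_target hg))] with w hw
  have hright := (chartAt Space (proj p)).right_inv hw
  rwa [chartAt_symm_eq_proj, proj_smul] at hright

theorem contMDiff_proj : ContMDiff 𝓘(ℝ, Space) 𝓘(ℝ, Space) ∞ proj := by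
  intro p
  obtain ⟨g, hg⟩ := exists_smul_eq_basePoint p
  have hchart : ContMDiffAt 𝓘(ℝ, Space) 𝓘(ℝ, Space) ∞ (chartAt Space (proj p)).symm (g • p) :=
    (contMDiffOn_chart_symm (n := ∞) (I := 𝓘(ℝ, Space)) (x := proj p)).contMDiffAt
      ((chartAt Space (proj p)).open_target.mem_nhds (smul_mem_chart_target hg))
  have hcomp := hchart.comp p (contDiff_deck_smul g).contDiffAt.contMDiffAt
  rwa [chartAt_symm_eq_proj, show proj ∘ (fun w : Space => g • w) = proj from
    funext (proj_smul g)] at hcomp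

theorem mfderiv_proj {p : Space} {g : Deck} (hg : g • p = basePoint (proj p)) :
    mfderiv 𝓘(ℝ, Space) 𝓘(ℝ, Space) proj p = deckLin g.k := by
  rw [((contMDiff_proj p).mdifferentiableAt (by simp)).mfderiv]
  simp only [extChartAt_model_space_eq_id, PartialEquiv.refl_coe, id_eq,
    ModelWithCorners.range_eq_univ, fderivWithin_univ]
  exact ((chartAt_comp_proj_eventuallyEq hg).fderiv_eq).trans (hasFDerivAt_deck_smul g p).fderiv

theorem mfderiv_chartAt_self (x : M) :
    mfderiv 𝓘(ℝ, Space) 𝓘(ℝ, Space) (chartAt Space x) x = ContinuousLinearMap.id ℝ Space := by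
  rw [mfderiv_chartAt_eq_tangentCoordChange (I := 𝓘(ℝ, Space)) (mem_chart_source Space x)]
  exact ContinuousLinearMap.ext fun v => tangentCoordChange_self (I := 𝓘(ℝ, Space)) (by simp)

/-- The common direction of the lines `{t} × ℝ` in `Space`. -/
def vertical : Submodule ℝ Space := LinearMap.ker (LinearMap.fst ℝ Plane ℝ)

theorem vertical_eq_span : vertical = Submodule.span ℝ {((0, 1) : Space)} := by
  ext ⟨t, s⟩
  simp [vertical, Submodule.mem_span_singleton, eq_comm]

theorem deckLin_mem_vertical (k : ℤ) {v : Space} (hv : v ∈ vertical) : deckLin k v ∈ vertical :=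
  (congrArg (shear k) hv).trans (map_zero (shear k))

theorem mfderiv_leaf (t : Plane) (s : ℝ) :
    (mfderiv 𝓘(ℝ, ℝ) 𝓘(ℝ, Space) (leaf t) s (1 : ℝ) : Space) = (0, 1) := by
  obtain ⟨g, hg⟩ := exists_smul_eq_basePoint (t, s)
  have hline : HasFDerivAt (fun s : ℝ => ((t, s) : Space)) (ContinuousLinearMap.inr ℝ Plane ℝ) s :=
    hasFDerivAt_prodMk_right t s
  have hleaf := ((contMDiff_proj (t, s)).mdifferentiableAt (by simp)).hasMFDerivAt.comp s
    hline.hasMFDerivAt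
  rw [show leaf t = proj ∘ fun s => ((t, s) : Space) from rfl, hleaf.mfderiv, mfderiv_proj hg]
  change deckLin g.k (0, 1) = (0, 1)
  rw [deckLin_apply, map_zero]

theorem leafTangent_eq_vertical (x : M) : leafTangent x = vertical := by
  rw [vertical_eq_span, leafTangent]
  congr 1
  ext v
  constructor
  · rintro ⟨t, s, -, hv⟩
    exact hv.trans (mfderiv_leaf t s)
  · intro hv
    exact ⟨(basePoint x).1, (basePoint x).2, proj_basePoint x, hv.trans (mfderiv_leaf _ _).symm⟩

end Covering

section Annihilates

variable {E F : Type*} [NormedAddCommGroup E] [NormedSpace ℝ E]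
  [NormedAddCommGroup F] [NormedSpace ℝ F] {k : ℕ} {L : Submodule ℝ E}

theorem annihilates_ker_compContinuousLinearMap (γ : F [⋀^Fin k]→L[ℝ] ℝ) (f : E →L[ℝ] F) :
    Annihilates (LinearMap.ker f.toLinearMap) (γ.compContinuousLinearMap f) :=
  fun _ ⟨i, hi⟩ => γ.map_coord_zero i hi

theorem Annihilates.apply_congr {γ : E [⋀^Fin k]→L[ℝ] ℝ} (h : Annihilates L γ) {w w' : Fin k → E}
    (hw : ∀ i, w i - w' i ∈ L) : γ w = γ w' := by
  have hsum := γ.toMultilinearMap.map_add_univ w' (w - w')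
  rw [add_sub_cancel, Finset.sum_eq_single Finset.univ] at hsum
  · simpa using hsum
  · intro s _ hs
    obtain ⟨i, hi⟩ : ∃ i, i ∉ s := by simpa [Finset.eq_univ_iff_forall] using hs
    exact h _ ⟨i, by simpa [Finset.piecewise, hi] using hw i⟩
  · exact fun hs => absurd (Finset.mem_univ _) hs

variable {β : E → E [⋀^Fin k]→L[ℝ] ℝ}

theorem fderiv_apply_eq_zero_of_annihilates (hβ : Differentiable ℝ β)
    (h₀ : ∀ p, Annihilates L (β p)) (h₁ : ∀ p, Annihilates L (extDeriv β p)) {v : E} (hv : v ∈ L)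
    (p : E) (w : Fin k → E) : fderiv ℝ (fun q => β q w) p v = 0 := by
  have h := h₁ p (Fin.cons v w : Fin (k + 1) → E) ⟨0, hv⟩
  rw [extDeriv_apply (hβ p), Fin.sum_univ_succ, Finset.sum_eq_zero, add_zero] at h
  · simpa using h
  · intro i _
    have hconst : (fun q => β q (i.succ.removeNth (Fin.cons v w : Fin (k + 1) → E))) =
        fun _ => 0 := by
      funext q
      obtain ⟨l, rfl⟩ : ∃ l, k = l + 1 := ⟨k - 1, by have := i.2; omega⟩
      exact h₀ q _ ⟨0, by simpa [Fin.removeNth] using hv⟩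
    simp [hconst]

theorem apply_add_eq_of_annihilates (hβ : Differentiable ℝ β)
    (h₀ : ∀ p, Annihilates L (β p)) (h₁ : ∀ p, Annihilates L (extDeriv β p)) {v : E} (hv : v ∈ L)
    (p : E) : β (p + v) = β p := by
  ext w
  have hderiv (r : ℝ) : HasDerivAt (fun r : ℝ => β (p + r • v) w) 0 r := by
    have hβw : DifferentiableAt ℝ (fun q => β q w) (p + r • v) :=
      (ContinuousAlternatingMap.apply ℝ E ℝ w).differentiableAt.comp _ (hβ _)
    have hline : HasDerivAt (fun r : ℝ => p + r • v) v r := by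
      simpa using ((hasDerivAt_id r).smul_const v).const_add p
    have hcomp := hβw.hasFDerivAt.comp_hasDerivAt r hline
    rwa [fderiv_apply_eq_zero_of_annihilates hβ h₀ h₁ hv] at hcomp
  simpa using is_const_of_deriv_eq_zero (fun r => (hderiv r).differentiableAt)
    (fun r => (hderiv r).deriv) 1 0

end Annihilates

section CoverForm

theorem minSmoothness_two_le_infty : minSmoothness ℝ 2 ≤ ∞ := by
  rw [minSmoothness_of_isRCLikeNormedField]
  exact WithTop.coe_le_coe.2 le_top

variable {k : ℕ}

/-- The pullback `q^* α` of a form on `M` to `Space`. -/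
noncomputable def coverForm (α : DiffForm Space M k) (p : Space) : Space [⋀^Fin k]→L[ℝ] ℝ :=
  (α (proj p)).compContinuousLinearMap (mfderiv 𝓘(ℝ, Space) 𝓘(ℝ, Space) proj p)

theorem chartForm_eq_coverForm (α : DiffForm Space M k) (x : M) :
    chartForm α x = coverForm α := by
  funext z
  rw [chartForm, coverForm, chartAt_symm_eq_proj]

theorem coverForm_eq (α : DiffForm Space M k) {p : Space} {x : M} (hx : proj p = x)
    {g : Deck} (hg : g • p = basePoint x) :
    coverForm α p = ContinuousAlternatingMap.compContinuousLinearMap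
      (show Space [⋀^Fin k]→L[ℝ] ℝ from α x) (deckLin g.k) := by
  subst hx
  rw [coverForm, mfderiv_proj hg]
  rfl

theorem coverForm_basePoint (α : DiffForm Space M k) (x : M) : coverForm α (basePoint x) = α x := by
  rw [coverForm_eq α (proj_basePoint x) (g := 1) (one_smul _ _), Deck.one_def, deckLin_zero]
  rfl

theorem coverForm_injective : Function.Injective (coverForm (k := k)) := fun α β h =>
  funext fun x => by rw [← coverForm_basePoint α, h, coverForm_basePoint]

theorem coverForm_smul (α : DiffForm Space M k) (g : Deck) (p : Space) :
    (coverForm α (g • p)).compContinuousLinearMap (deckLin g.k) = coverForm α p := by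
  obtain ⟨h, hh⟩ := exists_smul_eq_basePoint p
  have hh' : (h * g⁻¹) • g • p = basePoint (proj p) := by rw [mul_smul, inv_smul_smul, hh]
  have hk : h.k = (h * g⁻¹).k + g.k := (congrArg Deck.k (inv_mul_cancel_right h g)).symm
  rw [coverForm_eq α rfl hh, coverForm_eq α (proj_smul g p) hh', hk, deckLin_add]
  exact ContinuousAlternatingMap.ext fun w => rfl

theorem IsSmoothForm.contDiff_coverForm {α : DiffForm Space M k} (h : IsSmoothForm α) :
    ContDiff ℝ ∞ (coverForm α) := by
  refine contDiff_iff_contDiffAt.2 fun p => ?_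
  obtain ⟨g, hg⟩ := exists_smul_eq_basePoint p
  have hchart : ContDiffAt ℝ ∞ (coverForm α) (g • p) := by
    rw [← chartForm_eq_coverForm α (proj p)]
    exact (h (proj p)).contDiffAt
      ((chartAt Space (proj p)).open_target.mem_nhds (smul_mem_chart_target hg))
  rw [← funext (coverForm_smul α g)]
  exact (ContinuousAlternatingMap.compContinuousLinearMapCLM
    (deckLin g.k)).contDiff.contDiffAt.comp p (hchart.comp p (contDiff_deck_smul g).contDiffAt)

theorem extDerivForm_eq (α : DiffForm Space M k) (x : M) :
    extDerivForm α x = extDeriv (coverForm α) (basePoint x) := by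
  rw [extDerivForm, chartForm_eq_coverForm, mfderiv_chartAt_self]
  rfl

theorem IsSmoothForm.coverForm_extDerivForm {α : DiffForm Space M k} (h : IsSmoothForm α) :
    coverForm (extDerivForm α) = extDeriv (coverForm α) := by
  funext p
  obtain ⟨g, hg⟩ := exists_smul_eq_basePoint p
  have hpull := extDeriv_pullback (f := fun q : Space => g • q) (x := p) (r := ∞)
    (h.contDiff_coverForm.differentiable (by simp) (g • p)) (contDiff_deck_smul g).contDiffAt
    minSmoothness_two_le_infty
  simp only [(hasFDerivAt_deck_smul g _).fderiv, coverForm_smul] at hpull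
  rw [hpull, coverForm_eq _ rfl hg, extDerivForm_eq, hg]

theorem annihilates_vertical_coverForm {α : DiffForm Space M k}
    (h : ∀ x, Annihilates (leafTangent x) (α x)) (p : Space) :
    Annihilates vertical (coverForm α p) := by
  obtain ⟨g, hg⟩ := exists_smul_eq_basePoint p
  have hα := h (proj p)
  rw [leafTangent_eq_vertical] at hα
  rw [coverForm_eq α rfl hg]
  exact fun w ⟨i, hi⟩ => hα _ ⟨i, deckLin_mem_vertical g.k hi⟩

end CoverForm

section BasicForms

variable {k : ℕ}

/-- The pullback `pr^* τ` of a form on the plane under `(t, s) ↦ t`. -/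
noncomputable def prForm (τ : Plane → Plane [⋀^Fin k]→L[ℝ] ℝ) (p : Space) :
    Space [⋀^Fin k]→L[ℝ] ℝ :=
  (τ p.1).compContinuousLinearMap (ContinuousLinearMap.fst ℝ Plane ℝ)

/-- The restriction of a form on `Space` to the transversal `s = 0`. -/
noncomputable def restrictForm (β : Space → Space [⋀^Fin k]→L[ℝ] ℝ) (t : Plane) :
    Plane [⋀^Fin k]→L[ℝ] ℝ :=
  (β (t, 0)).compContinuousLinearMap (ContinuousLinearMap.inl ℝ Plane ℝ)

theorem contDiff_prForm {τ : Plane → Plane [⋀^Fin k]→L[ℝ] ℝ} {n : WithTop ℕ∞}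
    (h : ContDiff ℝ n τ) : ContDiff ℝ n (prForm τ) :=
  (ContinuousAlternatingMap.compContinuousLinearMapCLM (ι := Fin k) (F := ℝ)
    (ContinuousLinearMap.fst ℝ Plane ℝ)).contDiff.comp (h.comp contDiff_fst)

theorem contDiff_restrictForm {β : Space → Space [⋀^Fin k]→L[ℝ] ℝ} {n : WithTop ℕ∞}
    (h : ContDiff ℝ n β) : ContDiff ℝ n (restrictForm β) :=
  (ContinuousAlternatingMap.compContinuousLinearMapCLM (ι := Fin k) (F := ℝ)
    (ContinuousLinearMap.inl ℝ Plane ℝ)).contDiff.comp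
      (h.comp (contDiff_id.prodMk contDiff_const))

theorem extDeriv_prForm {τ : Plane → Plane [⋀^Fin k]→L[ℝ] ℝ} (h : Differentiable ℝ τ) :
    extDeriv (prForm τ) = prForm (extDeriv τ) := by
  funext p
  have hpull := extDeriv_pullback (f := (Prod.fst : Space → Plane)) (x := p) (r := ∞)
    (h p.1) contDiff_fst.contDiffAt minSmoothness_two_le_infty
  simp only [fderiv_fst] at hpull
  exact hpull

theorem prForm_restrictForm {β : Space → Space [⋀^Fin k]→L[ℝ] ℝ} (hβ : Differentiable ℝ β)
    (h₀ : ∀ p, Annihilates vertical (β p)) (h₁ : ∀ p, Annihilates vertical (extDeriv β p)) :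
    prForm (restrictForm β) = β := by
  funext ⟨t, s⟩
  have hs : β (t, s) = β (t, 0) := by
    simpa using apply_add_eq_of_annihilates hβ h₀ h₁ (v := (0, s)) rfl (t, 0)
  ext w
  rw [hs]
  exact (h₀ (t, 0)).apply_congr fun i => sub_self (w i).1

theorem TransverseForm.apply_shear (τ : TransverseForm k) (j : ℤ) (v : Plane) (w : Fin k → Plane) :
    τ.1 (shear j v) (fun i => shear j (w i)) = τ.1 v w := by
  induction j with
  | zero => simp only [shear_zero, ContinuousLinearMap.id_apply]
  | succ j ih => simp only [add_comm (j : ℤ), shear_add, shear_one, τ.apply_linA, ih]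
  | pred j ih =>
    have hj (u : Plane) : shear (-j) u = linA (shear (-j - 1) u) := by
      rw [← shear_one, ← shear_add, add_sub_cancel]
    simpa only [hj, τ.apply_linA] using ih

theorem prForm_smul (τ : TransverseForm k) (g : Deck) (p : Space) :
    (prForm τ.1 (g • p)).compContinuousLinearMap (deckLin g.k) = prForm τ.1 p := by
  ext w
  change τ.1 (shear g.k p.1 + _) (fun i => shear g.k (w i).1) = τ.1 p.1 fun i => (w i).1
  rw [τ.apply_add_intCast, τ.apply_shear]

/-- The form on `M` that an invariant form on the transversal induces. -/
noncomputable def descend (τ : TransverseForm k) : DiffForm Space M k :=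
  fun x => prForm τ.1 (basePoint x)

theorem coverForm_descend (τ : TransverseForm k) : coverForm (descend τ) = prForm τ.1 := by
  funext p
  obtain ⟨g, hg⟩ := exists_smul_eq_basePoint p
  rw [coverForm_eq _ rfl hg, ← prForm_smul τ g p, hg]
  rfl

theorem extDerivForm_descend (τ : TransverseForm k) :
    extDerivForm (descend τ) = descend (dT k τ) := by
  funext x
  rw [extDerivForm_eq, coverForm_descend, extDeriv_prForm (τ.2.1.differentiable (by simp))]
  rfl

theorem annihilates_leafTangent_descend (τ : TransverseForm k) (x : M) :
    Annihilates (leafTangent x) (descend τ x) := by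
  rw [leafTangent_eq_vertical]
  exact annihilates_ker_compContinuousLinearMap (τ.1 (basePoint x).1)
    (ContinuousLinearMap.fst ℝ Plane ℝ)

theorem descend_mem_basicForms (τ : TransverseForm k) : descend τ ∈ basicForms leafTangent k := by
  refine ⟨fun x => ?_, fun x => ⟨annihilates_leafTangent_descend τ x, ?_⟩⟩
  · rw [chartForm_eq_coverForm, coverForm_descend]
    exact (contDiff_prForm τ.2.1).contDiffOn
  · rw [extDerivForm_descend]
    exact annihilates_leafTangent_descend _ x

theorem prForm_restrictForm_coverForm {α : DiffForm Space M k}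
    (hα : α ∈ basicForms leafTangent k) : prForm (restrictForm (coverForm α)) = coverForm α :=
  prForm_restrictForm (hα.1.contDiff_coverForm.differentiable (by simp))
    (annihilates_vertical_coverForm fun x => (hα.2 x).1) <| by
      rw [← hα.1.coverForm_extDerivForm]
      exact annihilates_vertical_coverForm fun x => (hα.2 x).2

theorem restrictForm_coverForm_apply_shear {α : DiffForm Space M k}
    (hα : α ∈ basicForms leafTangent k) (g : Deck) (v : Plane) :
    (restrictForm (coverForm α) (shear g.k v + ![(g.m : ℝ), (g.n : ℝ)])).compContinuousLinearMap
      (shear g.k) = restrictForm (coverForm α) v := by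
  ext w
  have h := DFunLike.congr_fun (coverForm_smul α g (v, 0)) fun i => (w i, 0)
  rwa [← prForm_restrictForm_coverForm hα] at h

theorem restrictForm_coverForm_mem_transverseForms {α : DiffForm Space M k}
    (hα : α ∈ basicForms leafTangent k) : restrictForm (coverForm α) ∈ transverseForms k := by
  refine ⟨contDiff_restrictForm hα.1.contDiff_coverForm, fun n v => ?_, fun v => ?_⟩
  · have hn : (fun i => (n i : ℝ)) = ![(n 0 : ℝ), (n 1 : ℝ)] := (plane_eta _).symm
    have h := restrictForm_coverForm_apply_shear hα ⟨n 0, n 1, 0⟩ v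
    rw [shear_zero] at h
    rw [hn]
    exact h
  · have h := restrictForm_coverForm_apply_shear hα ⟨0, 0, 1⟩ v
    rwa [shear_one, show (![((0 : ℤ) : ℝ), ((0 : ℤ) : ℝ)] : Plane) = 0 by simp, add_zero] at h

/-- The identification of basic forms on `M` with invariant forms on the transversal, given by
restriction of `q^* α` to `s = 0`. -/
noncomputable def basicEquiv (k : ℕ) : basicForms leafTangent k ≃ₗ[ℝ] TransverseForm k where
  toFun α := ⟨restrictForm (coverForm α.1), restrictForm_coverForm_mem_transverseForms α.2⟩
  map_add' _ _ := rfl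
  map_smul' _ _ := rfl
  invFun τ := ⟨descend τ, descend_mem_basicForms τ⟩
  left_inv α := Subtype.ext <| coverForm_injective <| by
    exact (coverForm_descend _).trans (prForm_restrictForm_coverForm α.2)
  right_inv τ := Subtype.ext <| by
    change restrictForm (coverForm (descend τ)) = τ.1
    rw [coverForm_descend]
    rfl

theorem corresponds_basicEquiv (α : basicForms leafTangent k) :
    Corresponds α.1 (basicEquiv k α) := fun p w =>
  (DFunLike.congr_fun (congrFun (prForm_restrictForm_coverForm α.2) p) w).symm

theorem exists_basicEquiv_eq_dT (α : basicForms leafTangent k) :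
    ∃ β : basicForms leafTangent (k + 1),
      β.1 = extDerivForm α.1 ∧ basicEquiv (k + 1) β = dT k (basicEquiv k α) := by
  obtain ⟨τ, rfl⟩ := (basicEquiv k).symm.surjective α
  rw [LinearEquiv.apply_symm_apply]
  exact ⟨(basicEquiv (k + 1)).symm (dT k τ), (extDerivForm_descend τ).symm,
    LinearEquiv.apply_symm_apply _ _⟩

end BasicForms

section Operators

theorem extDeriv_scalar {F : ℝ → ℝ} {F' : ℝ} {v : Plane} (hF : HasDerivAt F F' (v 1)) :
    extDeriv (fun w : Plane => scalar (F (w 1))) v = F' • dy := by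
  have hcomp : HasFDerivAt (fun w : Plane => F (w 1))
      (F' • (ContinuousLinearMap.proj 1 : Plane →L[ℝ] ℝ)) v :=
    HasDerivAt.comp_hasFDerivAt (f := fun w : Plane => w 1) v hF
      (ContinuousLinearMap.proj 1 : Plane →L[ℝ] ℝ).hasFDerivAt
  change extDeriv (fun w => ContinuousAlternatingMap.constOfIsEmpty ℝ Plane (Fin 0) (F (w 1))) v = _
  rw [extDeriv_constOfIsEmpty, hcomp.fderiv]
  rfl

theorem coeffOne_eq_iff {τ : TransverseForm 1} {f : SmoothCircle} :
    coeffOne τ = f ↔ ∀ v, τ.1 v = f (circlePoint (v 1)) • dy := by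
  refine ⟨fun h v => h ▸ apply_eq_coeffOne_smul_dy τ v, fun h =>
    SmoothCircle.ext_circlePoint fun y => ?_⟩
  have hdy := DFunLike.congr_fun ((apply_eq_coeffOne_smul_dy τ ![0, y]).symm.trans (h ![0, y]))
    fun _ => stdBasis 1
  simpa [dy_stdBasis_one] using hdy

theorem coeffOne_dT (τ : TransverseForm 0) :
    coeffOne (dT 0 τ) = SmoothCircle.derivative (coeffZero τ) := by
  refine coeffOne_eq_iff.2 fun v => ?_
  change extDeriv τ.1 v = _
  rw [show τ.1 = _ from funext (apply_eq_scalar_coeffZero τ)]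
  exact extDeriv_scalar ((coeffZero τ).hasDerivAt_comp_circlePoint (v 1))

theorem dT_one : dT 1 = 0 := by
  refine LinearMap.ext fun τ => Subtype.ext ?_
  have hf := (coeffOne τ).contDiff_comp_circlePoint
  -- A primitive of `f` need not be periodic, but `f(y) dy` is exact on the plane.
  let F (y : ℝ) : ℝ := ∫ r in (0 : ℝ)..y, coeffOne τ (circlePoint r)
  have hF : ContDiff ℝ ∞ fun v : Plane => scalar (F (v 1)) :=
    (ContinuousAlternatingMap.constOfIsEmptyLIE ℝ Plane ℝ (Fin 0)).contDiff.comp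
      ((contDiff_integral_of_contDiff hf 0).comp (contDiff_apply ℝ ℝ 1))
  have hτ : τ.1 = extDeriv fun v : Plane => scalar (F (v 1)) := funext fun v => by
    rw [apply_eq_coeffOne_smul_dy]
    exact (extDeriv_scalar (hf.continuous.integral_hasStrictDerivAt 0 (v 1)).hasDerivAt).symm
  change extDeriv τ.1 = 0
  rw [hτ]
  exact extDeriv_extDeriv hF minSmoothness_two_le_infty

theorem starT_one (h : 1 + 1 = 2) (τ : TransverseForm 1) : starT h τ = τ :=
  Subtype.ext (funext fun v => (isStar_one_iff _ _).1 (isStar_starCovector h (τ.1 v)))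

theorem coeffZero_starT (h : 2 + 0 = 2) (τ : TransverseForm 2) :
    coeffZero (starT h τ) = coeffTwo τ := by
  refine SmoothCircle.ext_circlePoint fun y => ?_
  have hstar := (isStar_two_iff _ _).1 (isStar_starCovector h (τ.1 ![0, y]))
  have h₀ := DFunLike.congr_fun ((apply_eq_scalar_coeffZero (starT h τ) ![0, y]).symm.trans hstar) 0
  have h₂ := DFunLike.congr_fun (apply_eq_coeffTwo_smul_areaForm τ ![0, y]) stdBasis
  rw [ContinuousAlternatingMap.smul_apply, areaForm_stdBasis, smul_eq_mul, mul_one] at h₂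
  exact h₀.trans h₂

theorem dTot_apply (T : TotalForms) : dTot T = Pi.single 1 (dT 0 (T 0)) := by
  funext k
  match k with
  | 0 => rfl
  | 1 => rfl
  | 2 => exact LinearMap.congr_fun dT_one (T 1)
  | k + 3 => exact (subsingleton_transverseForm (by omega)).elim _ _

theorem starTot_single_one (τ : TransverseForm 1) :
    starTot (Pi.single 1 τ) = Pi.single 1 τ := by
  funext k
  match k with
  | 0 => exact map_zero (starT (k := 2) rfl)
  | 1 => exact starT_one rfl τ
  | 2 => exact map_zero (starT (k := 0) rfl)
  | k + 3 => exact (subsingleton_transverseForm (by omega)).elim _ _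

theorem dLambda_apply (T : TotalForms) :
    dLambda T = Pi.single 1 (-dT 0 (starT rfl (T 2))) := by
  have hsign : signTot T 2 = -T 2 := by
    change (-1 : ℝ) ^ 3 • T 2 = -T 2
    norm_num
  change starTot (dTot (starTot (signTot T))) = _
  rw [dTot_apply, starTot_single_one]
  change Pi.single 1 (dT 0 (starT rfl (signTot T 2))) = _
  rw [hsign, map_neg, map_neg]

theorem dTot_comp_dLambda : dTot ∘ₗ dLambda = 0 := by
  refine LinearMap.ext fun T => ?_
  rw [LinearMap.comp_apply, dLambda_apply, dTot_apply, Pi.single_eq_of_ne (by decide), map_zero,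
    Pi.single_zero, LinearMap.zero_apply]

theorem dTot_single_zero (τ : TransverseForm 0) :
    dTot (Pi.single 0 τ) = Pi.single 1 (dT 0 τ) := by
  rw [dTot_apply, Pi.single_eq_same]

theorem range_dLambda_le_range_dTot : LinearMap.range dLambda ≤ LinearMap.range dTot := by
  rintro _ ⟨T, rfl⟩
  exact ⟨Pi.single 0 (-starT rfl (T 2)), by rw [dTot_single_zero, map_neg, dLambda_apply]⟩

end Operators

section DegreeParts

theorem degreePart_ker_dTot_zero :
    degreePart (LinearMap.ker dTot) 0 = LinearMap.ker (dT 0) := by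
  ext τ
  change dTot (Pi.single 0 τ) = 0 ↔ dT 0 τ = 0
  rw [dTot_single_zero, Pi.single_eq_zero_iff]

theorem dTot_single_of_ne {k : ℕ} (hk : k ≠ 0) (τ : TransverseForm k) :
    dTot (Pi.single k τ) = 0 := by
  rw [dTot_apply, Pi.single_eq_of_ne hk.symm, map_zero, Pi.single_zero]

theorem dLambda_single_of_ne {k : ℕ} (hk : k ≠ 2) (τ : TransverseForm k) :
    dLambda (Pi.single k τ) = 0 := by
  rw [dLambda_apply, Pi.single_eq_of_ne hk.symm, map_zero, map_zero, neg_zero, Pi.single_zero]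

theorem degreePart_ker_dTot_of_ne {k : ℕ} (hk : k ≠ 0) :
    degreePart (LinearMap.ker dTot) k = ⊤ :=
  eq_top_iff.2 fun τ _ => dTot_single_of_ne hk τ

theorem degreePart_range_dTot_one :
    degreePart (LinearMap.range dTot) 1 = LinearMap.range (dT 0) := by
  ext τ
  constructor
  · rintro ⟨T, hT⟩
    rw [dTot_apply] at hT
    exact ⟨T 0, Pi.single_injective 1 hT⟩
  · rintro ⟨σ, rfl⟩
    exact ⟨Pi.single 0 σ, dTot_single_zero σ⟩

theorem degreePart_range_dTot_of_ne {k : ℕ} (hk : k ≠ 1) :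
    degreePart (LinearMap.range dTot) k = ⊥ := by
  refine eq_bot_iff.2 ?_
  rintro τ ⟨T, hT⟩
  have h := congrFun hT k
  rw [dTot_apply, Pi.single_eq_of_ne hk] at h
  exact (Pi.single_eq_same k τ).symm.trans h.symm

theorem degreePart_ker_dTot_add_dLambda_zero :
    degreePart (LinearMap.ker (dTot + dLambda)) 0 = LinearMap.ker (dT 0) := by
  ext τ
  change dTot (Pi.single 0 τ) + dLambda (Pi.single 0 τ) = 0 ↔ dT 0 τ = 0
  rw [dLambda_single_of_ne (by decide), add_zero, dTot_single_zero, Pi.single_eq_zero_iff]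

theorem degreePart_ker_dTot_add_dLambda_one :
    degreePart (LinearMap.ker (dTot + dLambda)) 1 = ⊤ :=
  eq_top_iff.2 fun τ _ => by
    change dTot (Pi.single 1 τ) + dLambda (Pi.single 1 τ) = 0
    rw [dTot_single_of_ne (by decide), dLambda_single_of_ne (by decide), add_zero]

theorem degreePart_ker_dTot_add_dLambda_two :
    degreePart (LinearMap.ker (dTot + dLambda)) 2 = LinearMap.ker (dT 0 ∘ₗ starT rfl) := by
  ext τ
  change dTot (Pi.single 2 τ) + dLambda (Pi.single 2 τ) = 0 ↔ dT 0 (starT rfl τ) = 0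
  rw [dTot_single_of_ne (by decide), zero_add, dLambda_apply, Pi.single_eq_same,
    Pi.single_eq_zero_iff, neg_eq_zero]

theorem degreePart_range_dTot_comp_dLambda (k : ℕ) :
    degreePart (LinearMap.range (dTot ∘ₗ dLambda)) k = ⊥ := by
  rw [dTot_comp_dLambda, LinearMap.range_zero]
  exact Submodule.ext fun _ => Pi.single_eq_zero_iff

theorem degreePart_ker_dTot_comp_dLambda (k : ℕ) :
    degreePart (LinearMap.ker (dTot ∘ₗ dLambda)) k = ⊤ := by
  rw [dTot_comp_dLambda, LinearMap.ker_zero]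
  exact Submodule.comap_top _

theorem mem_ker_dT_zero_iff {τ : TransverseForm 0} :
    τ ∈ LinearMap.ker (dT 0) ↔ ∀ z w, coeffZero τ z = coeffZero τ w := by
  rw [LinearMap.mem_ker, ← coeffOne.map_eq_zero_iff, coeffOne_dT,
    SmoothCircle.derivative_eq_zero_iff]

theorem mem_ker_dT_comp_starT_iff {τ : TransverseForm 2} :
    τ ∈ LinearMap.ker (dT 0 ∘ₗ starT rfl) ↔ ∀ z w, coeffTwo τ z = coeffTwo τ w := by
  rw [← coeffZero_starT rfl]
  exact mem_ker_dT_zero_iff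

theorem range_dT_zero :
    LinearMap.range (dT 0) = LinearMap.ker (SmoothCircle.mean ∘ₗ coeffOne.toLinearMap) := by
  ext τ
  constructor
  · rintro ⟨σ, rfl⟩
    change SmoothCircle.mean (coeffOne (dT 0 σ)) = 0
    rw [coeffOne_dT, SmoothCircle.mean_derivative]
  · intro hτ
    obtain ⟨F, hF⟩ := SmoothCircle.exists_derivative_eq_of_mean_eq_zero hτ
    refine ⟨coeffZero.symm F, coeffOne.injective ?_⟩
    rw [coeffOne_dT, coeffZero.apply_symm_apply, hF, LinearEquiv.coe_toLinearMap]

end DegreeParts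

section Quotients

theorem exists_quotient_equiv {R V W : Type*} [Ring R] [AddCommGroup V] [Module R V]
    [AddCommGroup W] [Module R W] {Z B : Submodule R V} (φ : V →ₗ[R] W)
    (hsurj : ∀ w, ∃ z ∈ Z, φ z = w) (hker : ∀ z ∈ Z, φ z = 0 ↔ z ∈ B) :
    ∃ h : (Z ⧸ B.submoduleOf Z) ≃ₗ[R] W, ∀ z : Z, h (Submodule.Quotient.mk z) = φ z.1 := by
  have hB : B.submoduleOf Z = LinearMap.ker (φ ∘ₗ Z.subtype) :=
    Submodule.ext fun z => (hker z.1 z.2).symm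
  have hφ : Function.Surjective (φ ∘ₗ Z.subtype) := fun w => by
    obtain ⟨z, hz, rfl⟩ := hsurj w
    exact ⟨⟨z, hz⟩, rfl⟩
  exact ⟨(Submodule.quotEquivOfEq _ _ hB).trans (LinearMap.quotKerEquivOfSurjective _ hφ),
    fun z => rfl⟩

theorem exists_quotient_equiv_of_eq_top_of_eq_bot {R V W : Type*} [Ring R] [AddCommGroup V]
    [Module R V] [AddCommGroup W] [Module R W] {Z B : Submodule R V} (e : V ≃ₗ[R] W) (hZ : Z = ⊤)
    (hB : B = ⊥) :
    ∃ h : (Z ⧸ B.submoduleOf Z) ≃ₗ[R] W, ∀ z : Z, h (Submodule.Quotient.mk z) = e z.1 := by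
  subst hZ hB
  exact exists_quotient_equiv e.toLinearMap (fun w => ⟨e.symm w, trivial, e.apply_symm_apply w⟩)
    fun _ _ => e.map_eq_zero_iff

variable {V : Type*} [AddCommGroup V] [Module ℝ V] {Z B : Submodule ℝ V} (e : V ≃ₗ[ℝ] SmoothCircle)

theorem exists_quotient_equiv_const (hZ : ∀ v, v ∈ Z ↔ ∀ z w, e v z = e v w) (hB : B = ⊥) :
    ∃ h : (Z ⧸ B.submoduleOf Z) ≃ₗ[ℝ] ℝ, ∀ (z : Z) c, e z.1 c = h (Submodule.Quotient.mk z) := by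
  subst hB
  let eval : V →ₗ[ℝ] ℝ :=
    { toFun v := e v 1
      map_add' v w := by rw [map_add]; rfl
      map_smul' a v := by rw [map_smul]; rfl }
  obtain ⟨h, hh⟩ := exists_quotient_equiv (Z := Z) (B := ⊥) eval (fun a => by
    let const : SmoothCircle := ⟨fun _ => a, contMDiff_const⟩
    have hconst (z : Circle) : e (e.symm const) z = a := by rw [e.apply_symm_apply]; rfl
    exact ⟨e.symm const, (hZ _).2 fun z w => by rw [hconst, hconst], hconst 1⟩) fun v hv => by
      rw [Submodule.mem_bot, ← e.map_eq_zero_iff]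
      exact ⟨fun h₁ => ContMDiffMap.ext fun z => ((hZ v).1 hv z 1).trans h₁,
        fun h₀ => DFunLike.congr_fun h₀ 1⟩
  exact ⟨h, fun z c => ((hZ z.1).1 z.2 c 1).trans (hh z).symm⟩

theorem exists_quotient_equiv_mean (hZ : Z = ⊤)
    (hB : B = LinearMap.ker (SmoothCircle.mean ∘ₗ e.toLinearMap)) :
    ∃ h : (Z ⧸ B.submoduleOf Z) ≃ₗ[ℝ] ℝ, ∀ z : Z, h (Submodule.Quotient.mk z) =
      ∫ y in (0 : ℝ)..1, e z.1 (circlePoint y) := by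
  subst hZ hB
  refine exists_quotient_equiv (SmoothCircle.mean ∘ₗ e.toLinearMap) (fun a => ?_) fun _ _ => Iff.rfl
  let const : SmoothCircle := ⟨fun _ => a, contMDiff_const⟩
  refine ⟨e.symm const, trivial, ?_⟩
  change SmoothCircle.mean (e (e.symm const)) = a
  rw [e.apply_symm_apply]
  exact (intervalIntegral.integral_const a).trans (by simp)

theorem not_finiteDimensional_of_equiv (h : V ≃ₗ[ℝ] SmoothCircle) : ¬ FiniteDimensional ℝ V :=
  fun _ => SmoothCircle.not_finiteDimensional h.finiteDimensional

end Quotients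

section Cohomologies

theorem exists_hBasic_zero_equiv : ∃ h : HBasic 0 ≃ₗ[ℝ] ℝ,
    ∀ z c, coeffZero z.1 c = h (Submodule.Quotient.mk z) :=
  exists_quotient_equiv_const coeffZero
    (fun _ => degreePart_ker_dTot_zero ▸ mem_ker_dT_zero_iff)
    (degreePart_range_dTot_of_ne (by decide))

theorem exists_hBasic_one_equiv : ∃ h : HBasic 1 ≃ₗ[ℝ] ℝ,
    ∀ z, h (Submodule.Quotient.mk z) = ∫ y in (0 : ℝ)..1, coeffOne z.1 (circlePoint y) :=
  exists_quotient_equiv_mean coeffOne (degreePart_ker_dTot_of_ne (by decide))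
    (degreePart_range_dTot_one.trans range_dT_zero)

theorem exists_hBasic_two_equiv : ∃ h : HBasic 2 ≃ₗ[ℝ] SmoothCircle,
    ∀ z, h (Submodule.Quotient.mk z) = coeffTwo z.1 :=
  exists_quotient_equiv_of_eq_top_of_eq_bot coeffTwo (degreePart_ker_dTot_of_ne (by decide))
    (degreePart_range_dTot_of_ne (by decide))

theorem exists_hSum_zero_equiv : ∃ h : HSum 0 ≃ₗ[ℝ] ℝ,
    ∀ z c, coeffZero z.1 c = h (Submodule.Quotient.mk z) :=
  exists_quotient_equiv_const coeffZero
    (fun _ => degreePart_ker_dTot_add_dLambda_zero ▸ mem_ker_dT_zero_iff)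
    (degreePart_range_dTot_comp_dLambda 0)

theorem exists_hSum_one_equiv : ∃ h : HSum 1 ≃ₗ[ℝ] SmoothCircle,
    ∀ z, h (Submodule.Quotient.mk z) = coeffOne z.1 :=
  exists_quotient_equiv_of_eq_top_of_eq_bot coeffOne degreePart_ker_dTot_add_dLambda_one
    (degreePart_range_dTot_comp_dLambda 1)

theorem exists_hSum_two_equiv : ∃ h : HSum 2 ≃ₗ[ℝ] ℝ,
    ∀ z c, coeffTwo z.1 c = h (Submodule.Quotient.mk z) :=
  exists_quotient_equiv_const coeffTwo
    (fun _ => degreePart_ker_dTot_add_dLambda_two ▸ mem_ker_dT_comp_starT_iff)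
    (degreePart_range_dTot_comp_dLambda 2)

theorem exists_hProd_equiv_of_ne {k : ℕ} (hk : k ≠ 1) (e : TransverseForm k ≃ₗ[ℝ] SmoothCircle) :
    ∃ h : HProd k ≃ₗ[ℝ] SmoothCircle, ∀ z, h (Submodule.Quotient.mk z) = e z.1 :=
  exists_quotient_equiv_of_eq_top_of_eq_bot e (degreePart_ker_dTot_comp_dLambda k) <| by
    rw [sup_eq_left.2 range_dLambda_le_range_dTot, degreePart_range_dTot_of_ne hk]

theorem exists_hProd_one_equiv : ∃ h : HProd 1 ≃ₗ[ℝ] ℝ,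
    ∀ z, h (Submodule.Quotient.mk z) = ∫ y in (0 : ℝ)..1, coeffOne z.1 (circlePoint y) :=
  exists_quotient_equiv_mean coeffOne (degreePart_ker_dTot_comp_dLambda 1) <| by
    rw [sup_eq_left.2 range_dLambda_le_range_dTot, degreePart_range_dTot_one, range_dT_zero]

end Cohomologies

end Suspension

theorem mainTheorem5 :
    -- `dx ∧ dy` is a transverse symplectic form
    ((fun _ => Suspension.areaForm) ∈ Suspension.transverseForms 2 ∧
      extDeriv (fun _ : Suspension.Plane => Suspension.areaForm) = 0 ∧
      ∀ u : Suspension.Plane, u ≠ 0 → ∃ w, Suspension.areaForm ![u, w] ≠ 0) ∧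
    -- basic forms on `M` are the invariant forms on the transversal, compatibly with `d`
    (∃ Φ : (k : ℕ) → Suspension.basicForms Suspension.leafTangent k ≃ₗ[ℝ]
          Suspension.TransverseForm k,
      (∀ k α, Suspension.Corresponds α.1 (Φ k α)) ∧
      ∀ k α, ∃ β : Suspension.basicForms Suspension.leafTangent (k + 1),
        β.1 = Suspension.extDerivForm α.1 ∧ Φ (k + 1) β = Suspension.dT k (Φ k α)) ∧
    -- they are `f(y)`, `f(y) dy` and `f(y) dx ∧ dy`
    (∀ k, 3 ≤ k → Subsingleton (Suspension.TransverseForm k)) ∧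
    ∃ (e₀ : Suspension.TransverseForm 0 ≃ₗ[ℝ] Suspension.SmoothCircle)
      (e₁ : Suspension.TransverseForm 1 ≃ₗ[ℝ] Suspension.SmoothCircle)
      (e₂ : Suspension.TransverseForm 2 ≃ₗ[ℝ] Suspension.SmoothCircle),
      (∀ τ v, τ.1 v = Suspension.scalar (e₀ τ (Suspension.circlePoint (v 1)))) ∧
      (∀ τ v, τ.1 v = e₁ τ (Suspension.circlePoint (v 1)) • Suspension.dy) ∧
      (∀ τ v, τ.1 v = e₂ τ (Suspension.circlePoint (v 1)) • Suspension.areaForm) ∧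
      -- basic cohomology
      (∃ h : Suspension.HBasic 0 ≃ₗ[ℝ] ℝ,
        ∀ z c, e₀ z.1 c = h (Submodule.Quotient.mk z)) ∧
      (∃ h : Suspension.HBasic 1 ≃ₗ[ℝ] ℝ,
        ∀ z, h (Submodule.Quotient.mk z) =
          ∫ y in (0 : ℝ)..1, e₁ z.1 (Suspension.circlePoint y)) ∧
      (∃ h : Suspension.HBasic 2 ≃ₗ[ℝ] Suspension.SmoothCircle,
        ∀ z, h (Submodule.Quotient.mk z) = e₂ z.1) ∧
      -- the `(d + d^Λ)`-cohomology
      (∃ h : Suspension.HSum 0 ≃ₗ[ℝ] ℝ,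
        ∀ z c, e₀ z.1 c = h (Submodule.Quotient.mk z)) ∧
      (∃ h : Suspension.HSum 1 ≃ₗ[ℝ] Suspension.SmoothCircle,
        ∀ z, h (Submodule.Quotient.mk z) = e₁ z.1) ∧
      (∃ h : Suspension.HSum 2 ≃ₗ[ℝ] ℝ,
        ∀ z c, e₂ z.1 c = h (Submodule.Quotient.mk z)) ∧
      -- the `d d^Λ`-cohomology
      (∃ h : Suspension.HProd 0 ≃ₗ[ℝ] Suspension.SmoothCircle,
        ∀ z, h (Submodule.Quotient.mk z) = e₀ z.1) ∧
      (∃ h : Suspension.HProd 1 ≃ₗ[ℝ] ℝ,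
        ∀ z, h (Submodule.Quotient.mk z) =
          ∫ y in (0 : ℝ)..1, e₁ z.1 (Suspension.circlePoint y)) ∧
      (∃ h : Suspension.HProd 2 ≃ₗ[ℝ] Suspension.SmoothCircle,
        ∀ z, h (Submodule.Quotient.mk z) = e₂ z.1) ∧
      -- infinite dimension
      ¬ FiniteDimensional ℝ (Suspension.HBasic 2) ∧
      ¬ FiniteDimensional ℝ (Suspension.HSum 1) ∧
      ¬ FiniteDimensional ℝ (Suspension.HProd 0) ∧
      ¬ FiniteDimensional ℝ (Suspension.HProd 2) :=
  ⟨⟨Suspension.areaForm_mem_transverseForms, Suspension.extDeriv_const _,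
      fun _ => Suspension.exists_areaForm_ne_zero⟩,
    ⟨Suspension.basicEquiv, fun _ => Suspension.corresponds_basicEquiv,
      fun _ => Suspension.exists_basicEquiv_eq_dT⟩,
    fun _ => Suspension.subsingleton_transverseForm,
    Suspension.coeffZero, Suspension.coeffOne, Suspension.coeffTwo,
    Suspension.apply_eq_scalar_coeffZero, Suspension.apply_eq_coeffOne_smul_dy,
    Suspension.apply_eq_coeffTwo_smul_areaForm,
    Suspension.exists_hBasic_zero_equiv, Suspension.exists_hBasic_one_equiv,
    Suspension.exists_hBasic_two_equiv,
    Suspension.exists_hSum_zero_equiv, Suspension.exists_hSum_one_equiv,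
    Suspension.exists_hSum_two_equiv,
    Suspension.exists_hProd_equiv_of_ne (by decide) _, Suspension.exists_hProd_one_equiv,
    Suspension.exists_hProd_equiv_of_ne (by decide) _,
    Suspension.not_finiteDimensional_of_equiv Suspension.exists_hBasic_two_equiv.choose,
    Suspension.not_finiteDimensional_of_equiv Suspension.exists_hSum_one_equiv.choose,
    Suspension.not_finiteDimensional_of_equiv
      (Suspension.exists_hProd_equiv_of_ne (by decide) Suspension.coeffZero).choose,
    Suspension.not_finiteDimensional_of_equiv
      (Suspension.exists_hProd_equiv_of_ne (by decide) Suspension.coeffTwo).choose⟩
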